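/- Let $(X_i,T_i,S_i(0),S_i(1),Y_i(0),Y_i(1))$, $i=1,2,\dots$, be i.i.d., with covariates $X_i\in\mathbb R^p$, binary treatment $T_i\in\{0,1\}$, potential intermediates $U_i=(S_i(0),S_i(1))$ and potential outcomes $Y_i(0),Y_i(1)$; one observes $X_i$, $T_i$, $S_i=S_i(T_i)$ and $Y_i=Y_i(T_i)$. Assume treatment ignorability, $T_i\perp(S_i(0),S_i(1),Y_i(0),Y_i(1))\mid X_i$, positivity, $0<P(T_i=1\mid X_i)<1$, and the model $$Y_i\mid U_i,X_i,T_i=t\sim N(\beta_{t0}S_i(0)+\beta_{t1}S_i(1)+\lambda_t+\gamma^TX_i,\ \sigma_y^2),\qquad t=0,1,$$ $$U_i\mid X_i\sim N\left(\begin{pmatrix}\phi_0+\alpha^TX_i\\ \phi_1+\alpha^TX_i\end{pmatrix},\ \Sigma_s\right),\qquad \Sigma_s=\begin{pmatrix}\sigma_{s0}^2&\rho\sigma_{s0}\sigma_{s1}\\ \rho\sigma_{s0}\sigma_{s1}&\sigma_{s1}^2\end{pmatrix},$$ with true correlation $\rho=\rho^*\in(-1,1)$ and with $\sigma_y,\sigma_{s0},\sigma_{s1}>0$.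 All parameters except $\rho$ are known (equal to their true values, marked by an asterisk), and principal ignorability fails: at least one of $\beta_{01}^*,\beta_{10}^*$ is nonzero. Let $\rho$ have an integrable (possibly unnormalised) prior density on $(-1,1)$ that is continuous and positive at $\rho^*$, and let $\mathrm{Var}(\rho\mid\mathcal D_n)$ be the variance of the posterior distribution of $\rho$ given the observed data of the first $n$ units. Put $\bar T=n^{-1}\sum_{i=1}^nT_i$, $\beta_t=(\beta_{t0},\beta_{t1})^T$, $\zeta_t=\sigma_y^2+\beta_t^T\Sigma_s\beta_t$, $\psi_t=\sigma_{st}\beta_{tt}+\rho\,\sigma_{s,1-t}\beta_{t,1-t}$, and $$I(\bar T)=\bar T{\beta_{10}^*}^2{\sigma_{s0}^*}^2\left\{\frac{2{\rho^*}^2{\beta_{10}^*}^2{\sigma_{s0}^*}^2}{(\zeta_1^*-{\psi_1^*}^2)^2}+\frac1{\zeta_1^*-{\psi_1^*}^2}\right\}+(1-\bar T){\beta_{01}^*}^2{\sigma_{s1}^*}^2\left\{\frac{2{\rho^*}^2{\beta_{01}^*}^2{\sigma_{s1}^*}^2}{(\zeta_0^*-{\psi_0^*}^2)^2}+\frac1{\zeta_0^*-{\psi_0^*}^2}\right\}.$$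 Then, almost surely, $$\mathrm{Var}(\rho\mid\mathcal D_n)\sim n^{-1}I(\bar T)^{-1}\qquad(n\to\infty),$$ that is, the ratio of the two sides tends to $1$. Here $\zeta_0^*-{\psi_0^*}^2={\sigma_y^*}^2+(1-{\rho^*}^2){\beta_{01}^*}^2{\sigma_{s1}^*}^2$ and $\zeta_1^*-{\psi_1^*}^2={\sigma_y^*}^2+(1-{\rho^*}^2){\beta_{10}^*}^2{\sigma_{s0}^*}^2$. Moreover, for every fixed $n\ge1$, every fixed value of $\bar T$ in $(0,1)$ and fixed values of the other parameters, the approximation $n^{-1}I(\bar T)^{-1}$ tends to $+\infty$ as $(\beta_{01}^*,\beta_{10}^*)\to(0,0)$ through nonzero pairs. -/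

import Mathlib

open MeasureTheory ProbabilityTheory Filter Set
open scoped Topology Asymptotics Matrix

noncomputable section

namespace PrincipalStrat

/-- All parameters of the linear Gaussian model other than the correlation `ρ` of the two
potential intermediates. The treatment level `t` and the index of a potential intermediate `S(j)`
both run through `Fin 2 = {0, 1}`; `β t j` is the coefficient `β_{tj}` of `S(j)` in the outcome
model under treatment `t`. -/
structure Params (p : ℕ) where
  β : Matrix (Fin 2) (Fin 2) ℝ
  lam : Fin 2 → ℝ
  γ : Fin p → ℝ
  σy : ℝ
  φ : Fin 2 → ℝ
  α : Fin p → ℝ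
  σs : Fin 2 → ℝ

variable {p : ℕ}

/-- Mean `(φ₀ + αᵀx, φ₁ + αᵀx)` of the potential intermediates given covariates `x`. -/
def Params.meanS (θ : Params p) (x : Fin p → ℝ) : EuclideanSpace ℝ (Fin 2) :=
  WithLp.toLp 2 fun j => θ.φ j + θ.α ⬝ᵥ x

/-- Mean `β_tᵀ u + λ_t + γᵀx` of the outcome given `U = u`, covariates `x` and treatment `t`. -/
def Params.meanY (θ : Params p) (t : Fin 2) (u : EuclideanSpace ℝ (Fin 2)) (x : Fin p → ℝ) : ℝ :=
  ∑ j, θ.β t j * u j + θ.lam t + θ.γ ⬝ᵥ x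

/-- Covariance matrix `Σ_s` of the potential intermediates given the covariates. -/
def Params.covS (θ : Params p) (ρ : ℝ) : Matrix (Fin 2) (Fin 2) ℝ :=
  !![θ.σs 0 ^ 2, ρ * θ.σs 0 * θ.σs 1;
     ρ * θ.σs 0 * θ.σs 1, θ.σs 1 ^ 2]

/-- `ζ_t = σ_y² + β_tᵀ Σ_s β_t`. -/
def Params.zeta (θ : Params p) (ρ : ℝ) (t : Fin 2) : ℝ :=
  θ.σy ^ 2 + θ.β t ⬝ᵥ (θ.covS ρ *ᵥ θ.β t)

/-- `ψ_t = σ_{st} β_{tt} + ρ σ_{s,1-t} β_{t,1-t}`. -/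
def Params.psi (θ : Params p) (ρ : ℝ) (t : Fin 2) : ℝ :=
  θ.σs t * θ.β t t + ρ * θ.σs (1 - t) * θ.β t (1 - t)

/-- The information expression at treated fraction `τ`. -/
def Params.info (θ : Params p) (ρ τ : ℝ) : ℝ :=
  τ * θ.β 1 0 ^ 2 * θ.σs 0 ^ 2 *
      (2 * ρ ^ 2 * θ.β 1 0 ^ 2 * θ.σs 0 ^ 2 / (θ.zeta ρ 1 - θ.psi ρ 1 ^ 2) ^ 2
        + 1 / (θ.zeta ρ 1 - θ.psi ρ 1 ^ 2))
    + (1 - τ) * θ.β 0 1 ^ 2 * θ.σs 1 ^ 2 *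
      (2 * ρ ^ 2 * θ.β 0 1 ^ 2 * θ.σs 1 ^ 2 / (θ.zeta ρ 0 - θ.psi ρ 0 ^ 2) ^ 2
        + 1 / (θ.zeta ρ 0 - θ.psi ρ 0 ^ 2))

/-- The same parameters with `(β₀₁, β₁₀)` replaced by `(b₀₁, b₁₀)`. -/
def Params.withCross (θ : Params p) (b₀₁ b₁₀ : ℝ) : Params p :=
  { θ with β := !![θ.β 0 0, b₀₁; b₁₀, θ.β 1 1] }

/-- Conditional independence of `V` and `W` given `Z`, by the product rule for conditional
probabilities of events (on a standard Borel `Ω` this is `ProbabilityTheory.CondIndepFun`). -/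
def CondIndepGiven {Ω A B C : Type*} [MeasurableSpace Ω] [MeasurableSpace A] [MeasurableSpace B]
    [mC : MeasurableSpace C] (V : Ω → A) (W : Ω → B) (Z : Ω → C) (P : Measure Ω) : Prop :=
  ∀ (a : Set A) (b : Set B), MeasurableSet a → MeasurableSet b →
    P⟦V ⁻¹' a ∩ W ⁻¹' b | mC.comap Z⟧ =ᵐ[P]
      fun ω => (P⟦V ⁻¹' a | mC.comap Z⟧) ω * (P⟦W ⁻¹' b | mC.comap Z⟧) ω

/-- The units `i = 0, 1, 2, …` form an i.i.d. sample from the model with parameters `(θ, ρ)`.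
`X i` are the covariates, `T i` the treatment, `U i = (S_i(0), S_i(1))` the potential
intermediates and `Y i = (Y_i(0), Y_i(1))` the potential outcomes; the observed intermediate
and outcome are `U i ω (T i ω)` and `Y i ω (T i ω)`. -/
structure IsModelSample {Ω : Type*} [MeasurableSpace Ω] (P : Measure Ω) [IsProbabilityMeasure P]
    (θ : Params p) (ρ : ℝ) (X : ℕ → Ω → Fin p → ℝ) (T : ℕ → Ω → Fin 2)
    (U : ℕ → Ω → EuclideanSpace ℝ (Fin 2)) (Y : ℕ → Ω → Fin 2 → ℝ) : Prop where
  measurable_X : ∀ i, Measurable (X i)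
  measurable_T : ∀ i, Measurable (T i)
  measurable_U : ∀ i, Measurable (U i)
  measurable_Y : ∀ i, Measurable (Y i)
  /-- the units are independent -/
  indep : iIndepFun (fun i ω => (X i ω, T i ω, U i ω, Y i ω)) P
  /-- the units are identically distributed -/
  ident : ∀ i, IdentDistrib (fun ω => (X i ω, T i ω, U i ω, Y i ω))
    (fun ω => (X 0 ω, T 0 ω, U 0 ω, Y 0 ω)) P P
  /-- treatment ignorability: `T ⫫ (S(0), S(1), Y(0), Y(1)) | X` -/
  ignorability : ∀ i, CondIndepGiven (T i) (fun ω => (U i ω, Y i ω)) (X i) P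
  /-- positivity: `0 < P(T = 1 | X) < 1` -/
  positivity : ∀ i, ∀ᵐ ω ∂P,
    0 < (P⟦T i ⁻¹' {1} | MeasurableSpace.comap (X i) inferInstance⟧) ω ∧
      (P⟦T i ⁻¹' {1} | MeasurableSpace.comap (X i) inferInstance⟧) ω < 1
  /-- `U | X ∼ N(μ_s, Σ_s)` -/
  model_U : ∀ i, ∀ᵐ x ∂(P.map (X i)),
    condDistrib (U i) (X i) P x = multivariateGaussian (θ.meanS x) (θ.covS ρ)
  /-- the observed outcome satisfies `Y | U, X, T = t ∼ N(μ_{yt}, σ_y²)` -/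
  model_Y : ∀ i, ∀ᵐ z ∂(P.map (fun ω => (U i ω, X i ω, T i ω))),
    condDistrib (fun ω => Y i ω (T i ω)) (fun ω => (U i ω, X i ω, T i ω)) P z =
      gaussianReal (θ.meanY z.2.2 z.1 z.2.1) (Real.toNNReal (θ.σy ^ 2))

/-- Density at `u` of the bivariate normal distribution with mean `m` and nonsingular
covariance matrix `M`. -/
def bivariateNormalPDF (m : EuclideanSpace ℝ (Fin 2)) (M : Matrix (Fin 2) (Fin 2) ℝ)
    (u : EuclideanSpace ℝ (Fin 2)) : ℝ :=
  (2 * Real.pi * √M.det)⁻¹ *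
    Real.exp (-((fun j => u j - m j) ⬝ᵥ (M⁻¹ *ᵥ fun j => u j - m j)) / 2)

/-- Density of the observed `(Y, S)` at `(y, s)` given `X = x` and `T = t`: the density of
`(Y, S(0), S(1))` with the unobserved intermediate `S(1 - t)` integrated out. -/
def obsDensity (θ : Params p) (ρ : ℝ) (x : Fin p → ℝ) (t : Fin 2) (s y : ℝ) : ℝ :=
  ∫ r : ℝ,
    gaussianPDFReal (θ.meanY t (WithLp.toLp 2 fun j => if j = t then s else r) x)
        (Real.toNNReal (θ.σy ^ 2)) y *
      bivariateNormalPDF (θ.meanS x) (θ.covS ρ) (WithLp.toLp 2 fun j => if j = t then s else r)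

/-- Unnormalised posterior of `ρ` on `(-1, 1)`: prior density `f` times the likelihood of the
first `n` observations `(x i, t i, s i, y i)`, the parameters `θ` being known. -/
def rhoPosteriorUnnorm (θ : Params p) (f : ℝ → ℝ) (n : ℕ) (x : ℕ → Fin p → ℝ) (t : ℕ → Fin 2)
    (s y : ℕ → ℝ) : Measure ℝ :=
  (volume.restrict (Ioo (-1 : ℝ) 1)).withDensity fun ρ =>
    ENNReal.ofReal (f ρ * ∏ i ∈ Finset.range n, obsDensity θ ρ (x i) (t i) (s i) (y i))

/-- Posterior distribution of `ρ` given the first `n` observations. -/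
def rhoPosterior (θ : Params p) (f : ℝ → ℝ) (n : ℕ) (x : ℕ → Fin p → ℝ) (t : ℕ → Fin 2)
    (s y : ℕ → ℝ) : Measure ℝ :=
  (rhoPosteriorUnnorm θ f n x t s y univ)⁻¹ • rhoPosteriorUnnorm θ f n x t s y

/-- Posterior variance `Var(ρ | 𝒟)` from the observed data of the first `n` units. -/
def posteriorVar {Ω : Type*} (θ : Params p) (f : ℝ → ℝ) (X : ℕ → Ω → Fin p → ℝ)
    (T : ℕ → Ω → Fin 2) (U : ℕ → Ω → EuclideanSpace ℝ (Fin 2)) (Y : ℕ → Ω → Fin 2 → ℝ)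
    (n : ℕ) (ω : Ω) : ℝ :=
  Var[id; rhoPosterior θ f n (fun i => X i ω) (fun i => T i ω)
    (fun i => U i ω (T i ω)) (fun i => Y i ω (T i ω))]

/-- `T̄ = ∑ T_i / n`. -/
def treatedFraction {Ω : Type*} (T : ℕ → Ω → Fin 2) (n : ℕ) (ω : Ω) : ℝ :=
  (∑ i ∈ Finset.range n, ((T i ω : ℕ) : ℝ)) / n

end PrincipalStrat

end

/-!
The observed pair `(S, Y)` of a unit in arm `t` is a Gaussian regression. Put `z` for the
standardised intermediate, `c = β_{t,1-t} σ_{s,1-t}`, and `w` for the outcome minus its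
mean when the missing intermediate sits at its mean given the covariates. Integrating the missing intermediate out shows
that `z` is standard normal and `w ∣ z ∼ N(ρ c z, V)` with `V = σ_y² + (1 - ρ²) c²`, and `V` equals
`ζ_t - ψ_t²` (`obsDensity_eq`). So, up to a constant, the log-likelihood of `ρ` is `n G_n(ρ)`, with
`G_n` linear in eight averages over all units: for each arm, those of `1, z², z w, w²`, counted as zero for units in
the other arm. The coefficients are smooth in `ρ` on `[-1, 1]`.

By ignorability the centred intermediates are Gaussian and independent of `(X, T)`, and the outcome
noise is Gaussian and independent of `(U, X, T)` (`IsModelSample.centred_U`,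
`IsModelSample.centred_Y`). Hence the strong law gives the limits of the eight averages
(`IsModelSample.tendsto_average_armStat`). On an event of probability one the rest is
deterministic. The limit `G` of `G_n` has a strict maximum over `[-1, 1]` at the true correlation,
because `log u ≤ u - 1` and because a cross coefficient is nonzero; there `-G''` is the information
at the limiting treated fraction. As `G_n → G` together with second derivatives, maximisers `r n`
of `G_n` converge to the true value, `G_n` is nearly quadratic about `r n`, and it is uniformly
smaller away from `r n` (`exists_laplace_centers`). The maximisers must be used as centres, since
`n (r n - ρ)²` is not bounded. Laplace's method (`tendsto_laplace_moment`) with moments of order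
`0, 1, 2` then gives `n Var → I⁻¹` (`tendsto_laplace_variance`).

The final claim holds since the information is a positive combination of two functions of the cross
coefficients that are continuous and vanish exactly at `0`.
-/

noncomputable section

namespace PrincipalStrat

variable {p : ℕ}

/-! ### The observed-data density as a Gaussian regression -/

/-- Residual variance `v + (1 - ρ²) c²` in the regression of the outcome on the observed
standardised intermediate: `v` is the outcome noise and `c = β_{t,1-t} σ_{s,1-t}` the effect of the
standardised unobserved intermediate. -/
def regVar (v c ρ : ℝ) : ℝ := v + (1 - ρ ^ 2) * c ^ 2

/-- Log-density, up to an additive constant, of `N(ρ c z, regVar v c ρ)` at `w`. -/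
def regLogLik (v c ρ z w : ℝ) : ℝ :=
  -Real.log (regVar v c ρ) / 2 - (w - ρ * c * z) ^ 2 / (2 * regVar v c ρ)

lemma regVar_pos {v : ℝ} (hv : 0 < v) (c : ℝ) {ρ : ℝ} (hρ : ρ ∈ Icc (-1 : ℝ) 1) :
    0 < regVar v c ρ := by
  have : 0 ≤ 1 - ρ ^ 2 := by nlinarith [hρ.1, hρ.2]
  unfold regVar
  positivity

/-- Coefficient `β_{t,1-t} σ_{s,1-t}` of the standardised unobserved intermediate. -/
def Params.cross (θ : Params p) (t : Fin 2) : ℝ := θ.β t (1 - t) * θ.σs (1 - t)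

/-- The intermediate `s` under treatment `t`, standardised given the covariates. -/
def Params.stdS (θ : Params p) (x : Fin p → ℝ) (t : Fin 2) (s : ℝ) : ℝ :=
  (s - θ.meanS x t) / θ.σs t

/-- The outcome minus its mean when the unobserved intermediate sits at its conditional mean
given the covariates alone. -/
def Params.residual (θ : Params p) (x : Fin p → ℝ) (t : Fin 2) (s y : ℝ) : ℝ :=
  y - (θ.β t t * s + θ.β t (1 - t) * θ.meanS x (1 - t) + θ.lam t + θ.γ ⬝ᵥ x)

lemma integral_exp_neg_mul_sub_sq (a r₀ : ℝ) :
    ∫ r : ℝ, Real.exp (-a * (r - r₀) ^ 2) = √(Real.pi / a) := by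
  rw [integral_sub_right_eq_self (fun r : ℝ => Real.exp (-a * r ^ 2)) r₀, integral_gaussian]

/-- Integrating the unobserved coordinate `r` out of a bivariate normal density times a Gaussian
linear regression density, by completing the square in `r`. -/
lemma integral_regression_mul_bivariate {v σ τ ρ : ℝ} (hv : 0 < v) (hσ : 0 < σ) (hτ : 0 < τ)
    (hρ : ρ ∈ Ioo (-1 : ℝ) 1) (b m z w : ℝ) :
    ∫ r : ℝ, (√(2 * Real.pi * v))⁻¹ * Real.exp (-(w - b * (r - m)) ^ 2 / (2 * v)) *
        ((2 * Real.pi * √(σ ^ 2 * τ ^ 2 * (1 - ρ ^ 2)))⁻¹ *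
          Real.exp (-((z ^ 2 - 2 * ρ * z * ((r - m) / τ) + ((r - m) / τ) ^ 2) / (1 - ρ ^ 2)) / 2))
      = (2 * Real.pi * σ)⁻¹ * Real.exp (-z ^ 2 / 2) *
          Real.exp (regLogLik v (b * τ) ρ z w) := by
  have hk : 0 < 1 - ρ ^ 2 := by nlinarith [hρ.1, hρ.2]
  have hV : 0 < regVar v (b * τ) ρ := regVar_pos hv _ ⟨hρ.1.le, hρ.2.le⟩
  set V := regVar v (b * τ) ρ with hVdef
  set k := 1 - ρ ^ 2 with hkdef
  have hVe : V = v + k * (b * τ) ^ 2 := rfl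
  have hpi := Real.pi_pos
  have key : ∀ r : ℝ, (√(2 * Real.pi * v))⁻¹ * Real.exp (-(w - b * (r - m)) ^ 2 / (2 * v)) *
        ((2 * Real.pi * √(σ ^ 2 * τ ^ 2 * k))⁻¹ *
          Real.exp (-((z ^ 2 - 2 * ρ * z * ((r - m) / τ) + ((r - m) / τ) ^ 2) / k) / 2))
      = ((√(2 * Real.pi * v))⁻¹ * (2 * Real.pi * √(σ ^ 2 * τ ^ 2 * k))⁻¹ *
          Real.exp (-z ^ 2 / 2 - (w - ρ * (b * τ) * z) ^ 2 / (2 * V))) *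
        Real.exp (-(V / (2 * v * k * τ ^ 2)) *
          (r - (m + τ * ((b * τ) * w * k + ρ * z * v) / V)) ^ 2) := by
    intro r
    have e : -(w - b * (r - m)) ^ 2 / (2 * v) +
        -((z ^ 2 - 2 * ρ * z * ((r - m) / τ) + ((r - m) / τ) ^ 2) / k) / 2 =
        (-z ^ 2 / 2 - (w - ρ * (b * τ) * z) ^ 2 / (2 * V)) + -(V / (2 * v * k * τ ^ 2)) *
          (r - (m + τ * ((b * τ) * w * k + ρ * z * v) / V)) ^ 2 := by
      have hr : ρ ^ 2 = 1 - k := by rw [hkdef]; ring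
      obtain ⟨q, rfl⟩ : ∃ q, r = m + τ * q := ⟨(r - m) / τ, by field_simp; ring⟩
      have h1 : (m + τ * q - m) / τ = q := by field_simp; ring
      have h2 : m + τ * q - m = τ * q := by ring
      have h3 : m + τ * q - (m + τ * ((b * τ) * w * k + ρ * z * v) / V) =
        τ * (q - ((b * τ) * w * k + ρ * z * v) / V) := by ring
      rw [h1, h2, h3]
      have h4 : z ^ 2 - 2 * ρ * z * q + q ^ 2 = k * z ^ 2 + (q - ρ * z) ^ 2 := by
        rw [hkdef]; ring
      rw [h4]
      generalize hc : b * τ = c at *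
      have h5 : b * (τ * q) = c * q := by rw [← hc]; ring
      rw [h5]
      clear_value V k
      subst hVe
      field_simp
      ring
    rw [show ∀ A B C D : ℝ, A * B * (C * D) = A * C * (B * D) by intros; ring, ← Real.exp_add, e,
      Real.exp_add]
    ring
  simp_rw [key]
  rw [integral_const_mul, integral_exp_neg_mul_sub_sq, regLogLik, ← hVdef, sub_eq_add_neg (_ / _),
    sub_eq_add_neg (_ / _), Real.exp_add, Real.exp_add]
  have h1 : Real.exp (-Real.log V / 2) = (√V)⁻¹ := by
    rw [Real.sqrt_eq_rpow, ← Real.rpow_neg hV.le, Real.rpow_def_of_pos hV]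
    congr 1; ring
  have h2 : √(Real.pi / (V / (2 * v * k * τ ^ 2))) = √(2 * Real.pi * v) * √k * τ / √V := by
    rw [show Real.pi / (V / (2 * v * k * τ ^ 2)) = (2 * Real.pi * v) * k * τ ^ 2 / V by
      field_simp]
    rw [Real.sqrt_div (by positivity), Real.sqrt_mul (by positivity), Real.sqrt_mul (by positivity),
      Real.sqrt_sq hτ.le]
  have h3 : √(σ ^ 2 * τ ^ 2 * k) = σ * τ * √k := by
    rw [Real.sqrt_mul (by positivity), Real.sqrt_mul (by positivity), Real.sqrt_sq hσ.le,
      Real.sqrt_sq hτ.le]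
  rw [h1, h2, h3]
  have : √V ≠ 0 := (Real.sqrt_pos.2 hV).ne'
  have : √k ≠ 0 := (Real.sqrt_pos.2 hk).ne'
  have : √(2 * Real.pi * v) ≠ 0 := (Real.sqrt_pos.2 (by positivity)).ne'
  field_simp

/-- The observed-data density is, up to a factor free of `ρ`, the density of the Gaussian
regression of the residual on the standardised observed intermediate. -/
lemma obsDensity_eq (θ : Params p) (hσy : 0 < θ.σy) (hσs : ∀ t, 0 < θ.σs t) {ρ : ℝ}
    (hρ : ρ ∈ Ioo (-1 : ℝ) 1) (x : Fin p → ℝ) (t : Fin 2) (s y : ℝ) :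
    obsDensity θ ρ x t s y =
      (2 * Real.pi * θ.σs t)⁻¹ * Real.exp (-θ.stdS x t s ^ 2 / 2) *
        Real.exp (regLogLik (θ.σy ^ 2) (θ.cross t) ρ (θ.stdS x t s) (θ.residual x t s y)) := by
  have hk : 0 < 1 - ρ ^ 2 := by nlinarith [hρ.1, hρ.2]
  have h0 := hσs 0
  have h1 := hσs 1
  have hdet : (θ.covS ρ).det = θ.σs 0 ^ 2 * θ.σs 1 ^ 2 * (1 - ρ ^ 2) := by
    simp [Params.covS, Matrix.det_fin_two]; ring
  rw [Params.cross, ← integral_regression_mul_bivariate (by positivity) (hσs t) (hσs (1 - t)) hρ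
    (θ.β t (1 - t)) (θ.meanS x (1 - t))]
  unfold obsDensity gaussianPDFReal bivariateNormalPDF
  congr 1
  ext r
  rw [Real.coe_toNNReal _ (sq_nonneg _), hdet]
  have hinv : (θ.covS ρ)⁻¹ = (θ.σs 0 ^ 2 * θ.σs 1 ^ 2 * (1 - ρ ^ 2))⁻¹ •
      !![θ.σs 1 ^ 2, -(ρ * θ.σs 0 * θ.σs 1); -(ρ * θ.σs 0 * θ.σs 1), θ.σs 0 ^ 2] := by
    rw [Matrix.inv_def, hdet, Ring.inverse_eq_inv', Params.covS, Matrix.adjugate_fin_two_of]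
  rw [hinv]
  fin_cases t
  · simp [Params.meanY, Params.residual, Params.stdS, Fin.sum_univ_two, dotProduct,
      Matrix.mulVec]
    congr 3
    · ring
    · field_simp
      ring
  · simp [Params.meanY, Params.residual, Params.stdS, Fin.sum_univ_two, dotProduct,
      Matrix.mulVec]
    congr 3
    · ring
    · rw [mul_comm (θ.σs 0 ^ 2)]
    · field_simp
      ring

/-! ### Laplace's method -/

lemma integrable_pow_mul_exp_neg_mul_sq {b : ℝ} (hb : 0 < b) (k : ℕ) :
    Integrable fun u : ℝ => u ^ k * Real.exp (-b * u ^ 2) := by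
  have := integrable_rpow_mul_exp_neg_mul_sq hb (s := (k : ℝ))
    (by have : (0 : ℝ) ≤ k := k.cast_nonneg
        linarith)
  simpa only [Real.rpow_natCast] using this

lemma integrableOn_mul_pow_mul_exp {f g : ℝ → ℝ} (hf : IntegrableOn f (Ioo (-1 : ℝ) 1))
    (hg : ContinuousOn g (Icc (-1 : ℝ) 1)) (a c : ℝ) (k : ℕ) :
    IntegrableOn (fun x => f x * (x - a) ^ k * Real.exp (c * (g x - g a))) (Ioo (-1 : ℝ) 1) := by
  rw [← integrableOn_Icc_iff_integrableOn_Ioo] at hf ⊢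
  simp_rw [mul_assoc]
  refine hf.mul_continuousOn ?_ isCompact_Icc
  fun_prop

/-- Laplace's method along a sequence of log-likelihoods `n G_n` with moving centres `r n`: the
rescaled moments about `r n` converge to those of the limiting Gaussian kernel. The prior factor
`f` only needs to be integrable, and continuous at the limit `ρ` of the centres. -/
theorem tendsto_laplace_moment {G : ℕ → ℝ → ℝ} {r : ℕ → ℝ} {f : ℝ → ℝ} {ρ I : ℝ} (hI : 0 < I)
    (hρ : ρ ∈ Ioo (-1 : ℝ) 1) (hr : Tendsto r atTop (𝓝 ρ)) (hr1 : ∀ n, r n ∈ Icc (-1 : ℝ) 1)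
    (hG : ∀ n, ContinuousOn (G n) (Icc (-1 : ℝ) 1))
    (hloc : ∀ ε > 0, ∃ δ > 0, ∀ᶠ n in atTop, ∀ x, |x - r n| < δ →
      |G n x - G n (r n) + I / 2 * (x - r n) ^ 2| ≤ ε * (x - r n) ^ 2)
    (hfar : ∀ δ > 0, ∃ η > 0, ∀ᶠ n in atTop, ∀ x ∈ Icc (-1 : ℝ) 1, δ ≤ |x - r n| →
      G n x ≤ G n (r n) - η)
    (hf_int : IntegrableOn f (Ioo (-1 : ℝ) 1)) (hf_cont : ContinuousAt f ρ) (k : ℕ) :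
    Tendsto (fun n : ℕ => √(n : ℝ) ^ (k + 1) * ∫ x in Ioo (-1 : ℝ) 1,
        f x * (x - r n) ^ k * Real.exp (n * (G n x - G n (r n)))) atTop
      (𝓝 (f ρ * ∫ u : ℝ, u ^ k * Real.exp (-(I / 2) * u ^ 2))) := by
  set F : ℕ → ℝ → ℝ := fun n x => f x * (x - r n) ^ k * Real.exp (n * (G n x - G n (r n)))
    with hF
  have hFint : ∀ n, IntegrableOn (F n) (Ioo (-1 : ℝ) 1) := fun n =>
    integrableOn_mul_pow_mul_exp hf_int (hG n) (r n) n k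
  obtain ⟨δ₁, hδ₁, hf1⟩ : ∃ δ > 0, ∀ x, |x - ρ| < δ → |f x| ≤ |f ρ| + 1 ∧ x ∈ Ioo (-1 : ℝ) 1 := by
    have h1 : ∀ᶠ x in 𝓝 ρ, |f x| ≤ |f ρ| + 1 ∧ x ∈ Ioo (-1 : ℝ) 1 := by
      refine Filter.Eventually.and ?_ (isOpen_Ioo.mem_nhds hρ)
      filter_upwards [hf_cont.abs.eventually (gt_mem_nhds (lt_add_one |f ρ|))] with x hx
      exact hx.le
    obtain ⟨δ, hδ, h⟩ := Metric.eventually_nhds_iff.1 h1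
    exact ⟨δ, hδ, fun x hx => h (by rwa [Real.dist_eq])⟩
  obtain ⟨δ₂, hδ₂, hloc1⟩ := hloc (I / 4) (by positivity)
  set δ := min (δ₁ / 2) δ₂ with hδdef
  have hδ : 0 < δ := by positivity
  have hrδ : ∀ᶠ n in atTop, |r n - ρ| < δ₁ / 2 := by
    have := Metric.tendsto_atTop.1 hr (δ₁ / 2) (by positivity)
    obtain ⟨N, hN⟩ := this
    filter_upwards [eventually_ge_atTop N] with n hn
    rw [← Real.dist_eq]; exact hN n hn
  have hball : ∀ᶠ n in atTop, ∀ x, |x - r n| < δ → |f x| ≤ |f ρ| + 1 ∧ x ∈ Ioo (-1 : ℝ) 1 := by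
    filter_upwards [hrδ] with n hn x hx
    refine hf1 x ?_
    have := abs_sub_le x (r n) ρ
    have := hx.trans_le (min_le_left _ _)
    linarith
  set N : ℕ → ℝ → ℝ := fun n => (Metric.ball (r n) δ).indicator (F n) with hN
  -- the contribution of the shrinking neighbourhoods, in the variable `u = √n (x - r n)`
  have hnear : Tendsto (fun n : ℕ => √(n : ℝ) ^ (k + 1) * ∫ x, N n x) atTop
      (𝓝 (f ρ * ∫ u : ℝ, u ^ k * Real.exp (-(I / 2) * u ^ 2))) := by
    have hsub : ∀ᶠ n : ℕ in atTop, ∫ u : ℝ, √(n : ℝ) ^ k * N n (u / √(n : ℝ) + r n) =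
        √(n : ℝ) ^ (k + 1) * ∫ x, N n x := by
      filter_upwards with n
      rw [integral_const_mul, Measure.integral_comp_div (fun x => N n (x + r n)),
        integral_add_right_eq_self, abs_of_nonneg (Real.sqrt_nonneg _), smul_eq_mul, pow_succ,
        mul_assoc]
    refine Tendsto.congr' hsub ?_
    rw [← integral_const_mul]
    have hptw : ∀ (n : ℕ), 0 < n → ∀ u : ℝ, |u / √(n : ℝ)| < δ →
        √(n : ℝ) ^ k * N n (u / √(n : ℝ) + r n) = f (u / √(n : ℝ) + r n) *
          (u ^ k * Real.exp (n * (G n (u / √(n : ℝ) + r n) - G n (r n)))) := by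
      intro n hn u hu
      have hs : √(n : ℝ) ≠ 0 := by positivity
      rw [hN]
      simp only
      rw [indicator_of_mem (by rwa [Metric.mem_ball, Real.dist_eq, add_sub_cancel_right]), hF]
      simp only
      rw [add_sub_cancel_right, div_pow]
      field_simp
    have hsq : ∀ (n : ℕ), 0 < n → ∀ u : ℝ, n * (u / √(n : ℝ)) ^ 2 = u ^ 2 := by
      intro n hn u
      rw [div_pow, Real.sq_sqrt n.cast_nonneg]
      field_simp
    refine tendsto_integral_filter_of_dominated_convergence
      (fun u => (|f ρ| + 1) * |u ^ k * Real.exp (-(I / 4) * u ^ 2)|) ?_ ?_ ?_ ?_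
    · filter_upwards [hball, eventually_gt_atTop 0] with n hn hn0
      have hsub : Metric.ball (r n) δ ⊆ Ioo (-1) 1 := fun x hx =>
        (hn x (by rwa [← Real.dist_eq])).2
      have : Integrable (N n) :=
        ((hFint n).mono_set hsub).integrable_indicator measurableSet_ball
      have h1 := (this.comp_add_right (r n)).comp_div (R := √(n : ℝ)) (by positivity)
      exact (h1.const_mul _).aestronglyMeasurable
    · filter_upwards [hball, hloc1, eventually_gt_atTop 0] with n hn hl hn0
      refine Eventually.of_forall fun u => ?_
      by_cases hu : |u / √(n : ℝ)| < δ
      · rw [hptw n hn0 u hu, norm_mul, Real.norm_eq_abs, Real.norm_eq_abs]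
        refine mul_le_mul (hn _ (by simpa using hu)).1 ?_ (abs_nonneg _) (by positivity)
        rw [abs_mul, abs_mul, Real.abs_exp, Real.abs_exp]
        refine mul_le_mul_of_nonneg_left (Real.exp_le_exp.2 ?_) (abs_nonneg _)
        have h1 := (abs_le.1 (hl (u / √(n : ℝ) + r n)
          (by simpa using hu.trans_le (min_le_right _ _)))).2
        rw [add_sub_cancel_right] at h1
        have h2 := mul_le_mul_of_nonneg_left h1 (Nat.cast_nonneg (α := ℝ) n)
        have h3 := hsq n hn0 u
        nlinarith
      · rw [hN]
        simp only
        rw [indicator_of_notMem (by rwa [Metric.mem_ball, Real.dist_eq, add_sub_cancel_right])]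
        simp only [mul_zero, norm_zero]
        positivity
    · exact ((integrable_pow_mul_exp_neg_mul_sq (by positivity) k).abs).const_mul _
    · refine Eventually.of_forall fun u => ?_
      have hu0 : Tendsto (fun n : ℕ => u / √(n : ℝ)) atTop (𝓝 0) :=
        (Real.tendsto_sqrt_atTop.comp tendsto_natCast_atTop_atTop).const_div_atTop u
      have hsmall : ∀ d > 0, ∀ᶠ n : ℕ in atTop, |u / √(n : ℝ)| < d := by
        intro d hd
        have := hu0.abs
        rw [abs_zero] at this
        exact this.eventually (gt_mem_nhds hd)
      have hex : Tendsto (fun n : ℕ => n * (G n (u / √(n : ℝ) + r n) - G n (r n))) atTop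
          (𝓝 (-(I / 2) * u ^ 2)) := by
        rw [Metric.tendsto_atTop']
        intro e he
        obtain ⟨d, hd, hl⟩ := hloc (e / (2 * (u ^ 2 + 1))) (by positivity)
        obtain ⟨M, hM⟩ := eventually_atTop.1 (hl.and ((hsmall d hd).and (eventually_gt_atTop 0)))
        refine ⟨M, fun n hn => ?_⟩
        obtain ⟨h1, h2, h3⟩ := hM n hn.le
        have h4 := h1 (u / √(n : ℝ) + r n) (by simpa using h2)
        rw [add_sub_cancel_right] at h4
        have h5 := mul_le_mul_of_nonneg_left h4 (Nat.cast_nonneg (α := ℝ) n)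
        rw [Real.dist_eq]
        have h6 : n * (G n (u / √(n : ℝ) + r n) - G n (r n)) - -(I / 2) * u ^ 2 =
            n * (G n (u / √(n : ℝ) + r n) - G n (r n) + I / 2 * (u / √(n : ℝ)) ^ 2) := by
          rw [← hsq n h3 u]; ring
        rw [h6, abs_mul, Nat.abs_cast]
        refine h5.trans_lt ?_
        rw [mul_left_comm, hsq n h3 u, div_mul_eq_mul_div, div_lt_iff₀ (by positivity)]
        nlinarith [sq_nonneg u]
      have hfl : Tendsto (fun n : ℕ => f (u / √(n : ℝ) + r n)) atTop (𝓝 (f ρ)) := by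
        refine hf_cont.tendsto.comp ?_
        simpa using hu0.add hr
      have hlim := hfl.mul ((tendsto_const_nhds (x := u ^ k)).mul
        ((Real.continuous_exp.tendsto _).comp hex))
      refine hlim.congr' ?_
      filter_upwards [hsmall δ hδ, eventually_gt_atTop 0] with n h1 h2
      exact (hptw n h2 u h1).symm
  -- away from the centres the integrand is exponentially small
  obtain ⟨η, hη, hfar1⟩ := hfar δ hδ
  have hrest : Tendsto (fun n : ℕ => √(n : ℝ) ^ (k + 1) *
      ∫ x in Ioo (-1 : ℝ) 1 \ Metric.ball (r n) δ, F n x) atTop (𝓝 0) := by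
    have h1 : Tendsto (fun n : ℕ => √(n : ℝ) ^ (k + 1) * Real.exp (-η * n) *
        (2 ^ k * ∫ x in Ioo (-1 : ℝ) 1, |f x|)) atTop (𝓝 0) := by
      rw [← zero_mul (2 ^ k * ∫ x in Ioo (-1 : ℝ) 1, |f x|)]
      refine Tendsto.mul_const _ ?_
      have := (tendsto_rpow_mul_exp_neg_mul_atTop_nhds_zero ((k + 1 : ℝ) / 2) η hη).comp
        (tendsto_natCast_atTop_atTop (R := ℝ))
      refine this.congr fun n => ?_
      simp only [Function.comp]
      congr 1
      rw [Real.sqrt_eq_rpow, ← Real.rpow_natCast, ← Real.rpow_mul n.cast_nonneg]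
      congr 1
      push_cast
      ring
    refine squeeze_zero_norm' ?_ h1
    filter_upwards [hfar1] with n hn
    rw [norm_mul, norm_pow, Real.norm_of_nonneg (Real.sqrt_nonneg _), mul_assoc]
    refine mul_le_mul_of_nonneg_left ?_ (by positivity)
    have h2 : ∫ x in Ioo (-1 : ℝ) 1 \ Metric.ball (r n) δ, Real.exp (-η * n) * (2 ^ k * |f x|) ≤
        Real.exp (-η * n) * (2 ^ k * ∫ x in Ioo (-1 : ℝ) 1, |f x|) := by
      rw [integral_const_mul, integral_const_mul]
      refine mul_le_mul_of_nonneg_left (mul_le_mul_of_nonneg_left ?_ (by positivity))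
        (by positivity)
      exact setIntegral_mono_set hf_int.abs (Eventually.of_forall fun x => abs_nonneg _)
        (LE.le.eventuallyLE sdiff_subset)
    refine (norm_integral_le_of_norm_le ?_ ?_).trans h2
    · exact ((IntegrableOn.mono_set hf_int.abs sdiff_subset).const_mul _).const_mul _
    · refine (ae_restrict_iff' (measurableSet_Ioo.diff measurableSet_ball)).2
        (Eventually.of_forall fun x hx => ?_)
      have hxI : x ∈ Icc (-1 : ℝ) 1 := Ioo_subset_Icc_self hx.1
      have hd : δ ≤ |x - r n| := by
        have := hx.2
        rw [Metric.mem_ball, Real.dist_eq, not_lt] at this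
        exact this
      have h3 := hn x hxI hd
      rw [hF]
      simp only
      rw [norm_mul, norm_mul, Real.norm_eq_abs, Real.norm_eq_abs, Real.norm_eq_abs, Real.abs_exp,
        abs_pow, mul_comm, mul_comm |f x|]
      have h4 : |x - r n| ≤ 2 := by
        rw [abs_le]; constructor <;> linarith [(hr1 n).1, (hr1 n).2, hxI.1, hxI.2]
      refine mul_le_mul (Real.exp_le_exp.2 ?_) (by gcongr) (by positivity) (Real.exp_pos _).le
      nlinarith [Nat.cast_nonneg (α := ℝ) n]
  have hsum := hnear.add hrest
  rw [add_zero] at hsum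
  refine hsum.congr' ?_
  filter_upwards [hball] with n hn
  have hsub : Metric.ball (r n) δ ⊆ Ioo (-1) 1 := fun x hx =>
    (hn x (by rwa [← Real.dist_eq])).2
  rw [hN, ← mul_add, integral_indicator measurableSet_ball]
  congr 1
  have := integral_inter_add_sdiff (measurableSet_ball (x := r n) (ε := δ)) (hFint n)
  rwa [inter_eq_self_of_subset_right hsub] at this

/-- Combining the zeroth, first and second moments: the variance of the density proportional to
`f exp (n G_n)` on `(-1, 1)` is asymptotically `1 / (n I)`, and its mass is eventually positive. -/
theorem tendsto_laplace_variance {G : ℕ → ℝ → ℝ} {r : ℕ → ℝ} {f : ℝ → ℝ} {ρ I : ℝ} (hI : 0 < I)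
    (hf_pos : 0 < f ρ)
    (h : ∀ k : ℕ, Tendsto (fun n : ℕ => √(n : ℝ) ^ (k + 1) * ∫ x in Ioo (-1 : ℝ) 1,
        f x * (x - r n) ^ k * Real.exp (n * (G n x - G n (r n)))) atTop
      (𝓝 (f ρ * ∫ u : ℝ, u ^ k * Real.exp (-(I / 2) * u ^ 2)))) :
    (∀ᶠ n : ℕ in atTop, 0 < ∫ x in Ioo (-1 : ℝ) 1,
        f x * (x - r n) ^ 0 * Real.exp (n * (G n x - G n (r n)))) ∧
    Tendsto (fun n : ℕ => (n : ℝ) *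
      ((∫ x in Ioo (-1 : ℝ) 1, f x * (x - r n) ^ 2 * Real.exp (n * (G n x - G n (r n)))) /
        (∫ x in Ioo (-1 : ℝ) 1, f x * (x - r n) ^ 0 * Real.exp (n * (G n x - G n (r n)))) -
      ((∫ x in Ioo (-1 : ℝ) 1, f x * (x - r n) ^ 1 * Real.exp (n * (G n x - G n (r n)))) /
        (∫ x in Ioo (-1 : ℝ) 1, f x * (x - r n) ^ 0 * Real.exp (n * (G n x - G n (r n))))) ^ 2))
      atTop (𝓝 I⁻¹) := by
  set v : NNReal := ⟨I⁻¹, by positivity⟩ with hv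
  have hv0 : v ≠ 0 := by
    intro h0
    have : I⁻¹ = 0 := congrArg NNReal.toReal h0
    exact (inv_pos.2 hI).ne' this
  have hvI : (v : ℝ) = I⁻¹ := rfl
  -- moments of the Gaussian kernel, from those of `gaussianReal 0 I⁻¹`
  have hmom : ∀ k : ℕ, ∫ u : ℝ, u ^ k * Real.exp (-(I / 2) * u ^ 2) =
      √(2 * Real.pi * v) * ∫ u, u ^ k ∂(gaussianReal 0 v) := by
    intro k
    rw [integral_gaussianReal_eq_integral_smul hv0, ← integral_const_mul]
    congr 1
    ext u
    have : √(2 * Real.pi * v) ≠ 0 := by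
      have := Real.pi_pos
      have : (0 : ℝ) < v := by rw [hvI]; positivity
      positivity
    rw [gaussianPDFReal, smul_eq_mul, hvI, sub_zero]
    rw [hvI] at this
    have e : -(I / 2) * u ^ 2 = -u ^ 2 / (2 * I⁻¹) := by field_simp
    rw [e]
    field_simp
  set c := √(2 * Real.pi * v) with hc
  have hc0 : 0 < c := by
    have := Real.pi_pos
    have : (0 : ℝ) < v := by rw [hvI]; positivity
    positivity
  have m0 : ∫ u : ℝ, u ^ 0 ∂(gaussianReal 0 v) = 1 := by simp
  have m1 : ∫ u : ℝ, u ^ 1 ∂(gaussianReal 0 v) = 0 := by simp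
  have m2 : ∫ u : ℝ, u ^ 2 ∂(gaussianReal 0 v) = I⁻¹ := by
    have h1 := variance_fun_id_gaussianReal (μ := 0) (v := v)
    rw [variance_eq_integral (by fun_prop)] at h1
    simpa [hvI] using h1
  have h0 := h 0
  have h1 := h 1
  have h2 := h 2
  rw [hmom, m0, mul_one] at h0
  rw [hmom, m1] at h1
  rw [hmom, m2] at h2
  have hne : f ρ * c ≠ 0 := by positivity
  constructor
  · filter_upwards [h0.eventually (lt_mem_nhds (by positivity : 0 < f ρ * c)),
      eventually_gt_atTop 0] with n hn hn0
    exact pos_of_mul_pos_right hn (by positivity)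
  · have hlim := (h2.div h0 hne).sub ((h1.div h0 hne).pow 2)
    have e : f ρ * (c * I⁻¹) / (f ρ * c) - (f ρ * (c * 0) / (f ρ * c)) ^ 2 = I⁻¹ := by
      have := hf_pos.ne'
      have := hc0.ne'
      field_simp
      ring
    rw [e] at hlim
    refine hlim.congr' ?_
    filter_upwards [eventually_gt_atTop 0] with n hn0
    simp only [Pi.div_apply]
    set A := ∫ x in Ioo (-1 : ℝ) 1, f x * (x - r n) ^ 2 * Real.exp (n * (G n x - G n (r n)))
    set B := ∫ x in Ioo (-1 : ℝ) 1, f x * (x - r n) ^ 1 * Real.exp (n * (G n x - G n (r n)))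
    set C := ∫ x in Ioo (-1 : ℝ) 1, f x * (x - r n) ^ 0 * Real.exp (n * (G n x - G n (r n)))
    have hs : √(n : ℝ) ≠ 0 := by positivity
    have hsn : (n : ℝ) = √(n : ℝ) ^ 2 := (Real.sq_sqrt n.cast_nonneg).symm
    generalize √(n : ℝ) = s at hs hsn ⊢
    rw [hsn]
    by_cases hC : C = 0
    · simp [hC]
    · field_simp
      ring

/-! ### Maximum-likelihood centres -/

lemma exists_gap_of_unique_max {g : ℝ → ℝ} {ρ : ℝ} (hg : ContinuousOn g (Icc (-1 : ℝ) 1))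
    (hmax : ∀ x ∈ Icc (-1 : ℝ) 1, x ≠ ρ → g x < g ρ) {δ : ℝ} (hδ : 0 < δ) :
    ∃ η > 0, ∀ x ∈ Icc (-1 : ℝ) 1, δ ≤ |x - ρ| → g x ≤ g ρ - η := by
  have hK : IsCompact (Icc (-1 : ℝ) 1 ∩ {x | δ ≤ |x - ρ|}) :=
    isCompact_Icc.inter_right (isClosed_le continuous_const (by fun_prop))
  rcases (Icc (-1 : ℝ) 1 ∩ {x | δ ≤ |x - ρ|}).eq_empty_or_nonempty with he | hne
  · refine ⟨1, one_pos, fun x hx hd => ?_⟩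
    exact (he.subset ⟨hx, hd⟩ : x ∈ (∅ : Set ℝ)).elim
  · obtain ⟨x₀, hx₀, hm⟩ := hK.exists_isMaxOn hne (hg.mono inter_subset_left)
    refine ⟨g ρ - g x₀, sub_pos.2 (hmax x₀ hx₀.1 ?_), fun x hx hd => ?_⟩
    · rintro rfl
      have := hx₀.2
      simp at this
      linarith
    · have := hm ⟨hx, hd⟩
      simp only [mem_ofPred_eq] at this
      linarith

/-- If the second derivative stays within `ε` of `-I` near a critical point `a`, the function is
quadratic there up to an error `ε (x - a)²`. -/
lemma abs_sub_add_sq_le_of_second_deriv {g g₁ g₂ : ℝ → ℝ} {a I ε d : ℝ}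
    (hg : ∀ x, |x - a| < d → HasDerivAt g (g₁ x) x)
    (hg₁ : ∀ x, |x - a| < d → HasDerivAt g₁ (g₂ x) x) (ha : g₁ a = 0)
    (hb : ∀ x, |x - a| < d → |g₂ x + I| ≤ ε) {x : ℝ} (hx : |x - a| < d) :
    |g x - g a + I / 2 * (x - a) ^ 2| ≤ ε * (x - a) ^ 2 := by
  have hd0 : 0 < d := (abs_nonneg _).trans_lt hx
  have hε : 0 ≤ ε := (abs_nonneg _).trans (hb x hx)
  have hball : ∀ y ∈ Metric.ball a d, |y - a| < d := fun y hy => by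
    rwa [Metric.mem_ball, Real.dist_eq] at hy
  have h1 : ∀ y, |y - a| < d → |g₁ y + I * (y - a)| ≤ ε * |y - a| := by
    intro y hy
    have := (convex_ball a d).norm_image_sub_le_of_norm_hasDerivWithin_le
      (f := fun y => g₁ y + I * (y - a)) (f' := fun y => g₂ y + I) (C := ε) (x := a) (y := y)
      (fun z hz => ((hg₁ z (hball z hz)).add
        ((((hasDerivAt_id z).sub_const a).const_mul I).congr_deriv (by simp))).hasDerivWithinAt)
      (fun z hz => hb z (hball z hz)) (Metric.mem_ball_self hd0)
      (by rwa [Metric.mem_ball, Real.dist_eq])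
    simpa [ha] using this
  have hcb : ∀ y ∈ Metric.closedBall a |x - a|, |y - a| ≤ |x - a| := fun y hy => by
    rwa [Metric.mem_closedBall, Real.dist_eq] at hy
  have := (convex_closedBall a |x - a|).norm_image_sub_le_of_norm_hasDerivWithin_le
      (f := fun y => g y + I / 2 * (y - a) ^ 2) (f' := fun y => g₁ y + I * (y - a))
      (C := ε * |x - a|) (x := a) (y := x)
      (fun z hz => ((hg z ((hcb z hz).trans_lt hx)).add
        (((((hasDerivAt_id z).sub_const a).pow 2).const_mul (I / 2)).congr_deriv
          (by simp; ring))).hasDerivWithinAt)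
      (fun z hz => (h1 z ((hcb z hz).trans_lt hx)).trans
        (mul_le_mul_of_nonneg_left (hcb z hz) hε))
      (Metric.mem_closedBall_self (abs_nonneg _))
      (by rw [Metric.mem_closedBall, Real.dist_eq])
  rw [Real.norm_eq_abs, Real.norm_eq_abs, mul_assoc, ← sq, sq_abs] at this
  convert this using 2
  simp
  ring

/-- Maximum-likelihood centring. Let `G_n = ∑ₖ qₙₖ hₖ` be a log-likelihood that is linear in
finitely many empirical averages `qₙₖ → qₖ`, and let the limit `∑ₖ qₖ hₖ` have a unique maximum at
`ρ` with curvature `-I`. Maximisers `r n` of `G_n` are then centres that satisfy the local and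
global hypotheses of Laplace's method. -/
theorem exists_laplace_centers {ι : Type*} [Fintype ι] {h h₁ h₂ : ι → ℝ → ℝ} {q : ℕ → ι → ℝ}
    {q₀ : ι → ℝ} {ρ I : ℝ} (hρ : ρ ∈ Ioo (-1 : ℝ) 1) (hq : Tendsto q atTop (𝓝 q₀))
    (hc : ∀ k, ContinuousOn (h k) (Icc (-1 : ℝ) 1))
    (hd₁ : ∀ k, ∀ x ∈ Ioo (-1 : ℝ) 1, HasDerivAt (h k) (h₁ k x) x)
    (hd₂ : ∀ k, ∀ x ∈ Ioo (-1 : ℝ) 1, HasDerivAt (h₁ k) (h₂ k x) x)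
    (hc₂ : ∀ k, ContinuousAt (h₂ k) ρ)
    (hmax : ∀ x ∈ Icc (-1 : ℝ) 1, x ≠ ρ → ∑ k, q₀ k * h k x < ∑ k, q₀ k * h k ρ)
    (hcurv : ∑ k, q₀ k * h₂ k ρ = -I) :
    ∃ r : ℕ → ℝ, Tendsto r atTop (𝓝 ρ) ∧ (∀ n, r n ∈ Icc (-1 : ℝ) 1) ∧
      (∀ ε > 0, ∃ δ > 0, ∀ᶠ n in atTop, ∀ x, |x - r n| < δ →
        |∑ k, q n k * h k x - ∑ k, q n k * h k (r n) + I / 2 * (x - r n) ^ 2| ≤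
          ε * (x - r n) ^ 2) ∧
      (∀ δ > 0, ∃ η > 0, ∀ᶠ n in atTop, ∀ x ∈ Icc (-1 : ℝ) 1, δ ≤ |x - r n| →
        ∑ k, q n k * h k x ≤ ∑ k, q n k * h k (r n) - η) := by
  have hρ' : ρ ∈ Icc (-1 : ℝ) 1 := Ioo_subset_Icc_self hρ
  have hGc : ∀ q' : ι → ℝ, ContinuousOn (fun x => ∑ k, q' k * h k x) (Icc (-1 : ℝ) 1) := fun q' =>
    continuousOn_finsetSum _ fun k _ => (hc k).const_mul (q' k)
  have hex : ∀ n, ∃ r ∈ Icc (-1 : ℝ) 1, IsMaxOn (fun x => ∑ k, q n k * h k x) (Icc (-1 : ℝ) 1) r :=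
    fun n => isCompact_Icc.exists_isMaxOn ⟨ρ, hρ'⟩ (hGc (q n))
  choose r hrI hrmax using hex
  have hunif : ∀ e > 0, ∀ᶠ n in atTop, ∀ x ∈ Icc (-1 : ℝ) 1,
      |∑ k, q n k * h k x - ∑ k, q₀ k * h k x| ≤ e := by
    have hB : ∀ k, ∃ B, ∀ x ∈ Icc (-1 : ℝ) 1, ‖h k x‖ ≤ B := fun k =>
      isCompact_Icc.exists_bound_of_continuousOn (hc k)
    choose B hB using hB
    have hlim : Tendsto (fun n => ∑ k, |q n k - q₀ k| * B k) atTop (𝓝 0) := by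
      have : Tendsto (fun n => ∑ k, |q n k - q₀ k| * B k) atTop
          (𝓝 (∑ k, |q₀ k - q₀ k| * B k)) :=
        tendsto_finsetSum _ fun k _ =>
          (((tendsto_pi_nhds.1 hq k).sub_const _).abs).mul_const _
      simpa using this
    intro e he
    filter_upwards [hlim.eventually (gt_mem_nhds he)] with n hn x hx
    refine le_trans ?_ hn.le
    rw [← Finset.sum_sub_distrib]
    refine (Finset.abs_sum_le_sum_abs _ _).trans (Finset.sum_le_sum fun k _ => ?_)
    rw [← sub_mul, abs_mul]
    exact mul_le_mul_of_nonneg_left (hB k x hx) (abs_nonneg _)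
  have hmaxr : ∀ n, ∀ x ∈ Icc (-1 : ℝ) 1, ∑ k, q n k * h k x ≤ ∑ k, q n k * h k (r n) :=
    fun n x hx => hrmax n hx
  have hgap : ∀ δ > 0, ∃ η > 0, ∀ᶠ n in atTop, ∀ x ∈ Icc (-1 : ℝ) 1, δ ≤ |x - ρ| →
      ∑ k, q n k * h k x ≤ ∑ k, q n k * h k (r n) - η := by
    intro δ hδ
    obtain ⟨η, hη, hg⟩ := exists_gap_of_unique_max (hGc q₀) hmax hδ
    refine ⟨η / 3, by positivity, ?_⟩
    filter_upwards [hunif (η / 3) (by positivity)] with n hn x hx hxd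
    have h1 := hg x hx hxd
    have h2 := abs_le.1 (hn x hx)
    have h3 := abs_le.1 (hn ρ hρ')
    have h4 := hmaxr n ρ hρ'
    linarith [h2.1, h2.2, h3.1, h3.2]
  have hr : Tendsto r atTop (𝓝 ρ) := by
    rw [Metric.tendsto_nhds]
    intro δ hδ
    obtain ⟨η, hη, hg⟩ := hgap δ hδ
    filter_upwards [hg] with n hn
    rw [Real.dist_eq]
    by_contra hcon
    have := hn (r n) (hrI n) (not_lt.1 hcon)
    linarith
  refine ⟨r, hr, hrI, fun ε hε => ?_, fun δ hδ => ?_⟩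
  · have hcont : ContinuousAt (fun z : (ι → ℝ) × ℝ => ∑ k, z.1 k * h₂ k z.2) (q₀, ρ) := by
      refine tendsto_finsetSum _ fun k _ => Tendsto.mul ?_ ?_
      · exact ((continuous_apply k).comp continuous_fst).continuousAt
      · exact ContinuousAt.comp (f := Prod.snd) (x := (q₀, ρ)) (hc₂ k) continuousAt_snd
    have hev : ∀ᶠ z : (ι → ℝ) × ℝ in 𝓝 q₀ ×ˢ 𝓝 ρ,
        |∑ k, z.1 k * h₂ k z.2 + I| < ε ∧ z.2 ∈ Ioo (-1 : ℝ) 1 := by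
      rw [← nhds_prod_eq]
      have h1 : Tendsto (fun z : (ι → ℝ) × ℝ => |∑ k, z.1 k * h₂ k z.2 + I|) (𝓝 (q₀, ρ))
          (𝓝 0) := by
        have := (hcont.tendsto.add_const I).abs
        simpa only [hcurv, neg_add_cancel, abs_zero] using this
      exact (h1.eventually (gt_mem_nhds hε)).and
        (continuous_snd.continuousAt.eventually (isOpen_Ioo.mem_nhds hρ))
    obtain ⟨pa, hpa, pb, hpb, hpab⟩ := eventually_prod_iff.1 hev
    obtain ⟨d, hd, hdb⟩ := Metric.eventually_nhds_iff.1 hpb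
    refine ⟨d / 2, by positivity, ?_⟩
    have hclose : ∀ᶠ n in atTop, |r n - ρ| < d / 2 := by
      filter_upwards [Metric.tendsto_nhds.1 hr (d / 2) (by positivity)] with n hn
      rwa [← Real.dist_eq]
    filter_upwards [hq.eventually hpa, hclose] with n hn1 hn2 x hx
    have hall : ∀ y, |y - r n| < d / 2 →
        |∑ k, q n k * h₂ k y + I| < ε ∧ y ∈ Ioo (-1 : ℝ) 1 := fun y hy =>
      hpab hn1 (hdb (by rw [Real.dist_eq]; linarith [abs_sub_le y (r n) ρ]))
    have hder : ∀ y, |y - r n| < d / 2 →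
        HasDerivAt (fun x => ∑ k, q n k * h k x) (∑ k, q n k * h₁ k y) y := fun y hy =>
      HasDerivAt.fun_sum fun k _ => (hd₁ k y (hall y hy).2).const_mul _
    have hrn := (hall (r n) (by simpa using half_pos hd)).2
    refine abs_sub_add_sq_le_of_second_deriv (d := d / 2) (g := fun x => ∑ k, q n k * h k x)
      (g₁ := fun x => ∑ k, q n k * h₁ k x) (g₂ := fun x => ∑ k, q n k * h₂ k x) hder
      (fun y hy => HasDerivAt.fun_sum fun k _ => (hd₂ k y (hall y hy).2).const_mul _)
      ?_ (fun y hy => (hall y hy).1.le) hx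
    have hloc : IsLocalMax (fun x => ∑ k, q n k * h k x) (r n) :=
      (hrmax n).isLocalMax (Icc_mem_nhds hrn.1 hrn.2)
    exact hloc.hasDerivAt_eq_zero (hder (r n) (by simpa using half_pos hd))
  · obtain ⟨η, hη, hg⟩ := hgap (δ / 2) (by positivity)
    refine ⟨η, hη, ?_⟩
    filter_upwards [hg, Metric.tendsto_nhds.1 hr (δ / 2) (by positivity)] with n hn hn2 x hx hxd
    refine hn x hx ?_
    rw [Real.dist_eq] at hn2
    have := abs_sub_le x ρ (r n)
    rw [abs_sub_comm ρ] at this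
    linarith

/-! ### Log-likelihood of the correlation -/

/-- Sufficient statistics of one observation of the regression of `w` on `z`. -/
def llStat (z w : ℝ) : Fin 4 → ℝ := ![1, z ^ 2, z * w, w ^ 2]

/-- Coefficients of the sufficient statistics in the log-likelihood of the correlation. -/
def llCoef (v c : ℝ) : Fin 4 → ℝ → ℝ :=
  ![fun ρ => -Real.log (regVar v c ρ) / 2, fun ρ => -(ρ ^ 2 * c ^ 2) / (2 * regVar v c ρ),
    fun ρ => ρ * c / regVar v c ρ, fun ρ => -1 / (2 * regVar v c ρ)]

/-- First derivatives of the coefficients `llCoef`. -/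
def llCoefDeriv (v c : ℝ) : Fin 4 → ℝ → ℝ :=
  ![fun ρ => ρ * c ^ 2 / regVar v c ρ,
    fun ρ => -(ρ * c ^ 2) / regVar v c ρ - ρ ^ 3 * c ^ 4 / regVar v c ρ ^ 2,
    fun ρ => c / regVar v c ρ + 2 * ρ ^ 2 * c ^ 3 / regVar v c ρ ^ 2,
    fun ρ => -(ρ * c ^ 2) / regVar v c ρ ^ 2]

/-- Second derivatives of the coefficients `llCoef`. -/
def llCoefDeriv2 (v c : ℝ) : Fin 4 → ℝ → ℝ :=
  ![fun ρ => c ^ 2 / regVar v c ρ + 2 * ρ ^ 2 * c ^ 4 / regVar v c ρ ^ 2,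
    fun ρ => -c ^ 2 / regVar v c ρ - 5 * ρ ^ 2 * c ^ 4 / regVar v c ρ ^ 2
      - 4 * ρ ^ 4 * c ^ 6 / regVar v c ρ ^ 3,
    fun ρ => 6 * ρ * c ^ 3 / regVar v c ρ ^ 2 + 8 * ρ ^ 3 * c ^ 5 / regVar v c ρ ^ 3,
    fun ρ => -c ^ 2 / regVar v c ρ ^ 2 - 4 * ρ ^ 2 * c ^ 4 / regVar v c ρ ^ 3]

/-- Limits of the averages of `llStat` in a unit-mass sample: second moments of `(z, w)` when
`z` is standard normal and `w` given `z` is `N(ρ c z, regVar v c ρ)`. -/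
def llMean (v c ρ : ℝ) : Fin 4 → ℝ := ![1, 1, ρ * c, v + c ^ 2]

lemma regLogLik_eq_sum (v c ρ z w : ℝ) :
    regLogLik v c ρ z w = ∑ j, llStat z w j * llCoef v c j ρ := by
  simp [regLogLik, llStat, llCoef, Fin.sum_univ_four]
  ring

lemma hasDerivAt_regVar (v c x : ℝ) : HasDerivAt (regVar v c) (-(2 * x * c ^ 2)) x := by
  have := (((hasDerivAt_id x).pow 2).const_sub 1).mul_const (c ^ 2) |>.const_add v
  refine this.congr_deriv ?_
  simp

lemma continuous_regVar (v c : ℝ) : Continuous (regVar v c) :=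
  continuous_iff_continuousAt.2 fun x => (hasDerivAt_regVar v c x).continuousAt

lemma hasDerivAt_llCoef {v : ℝ} (hv : 0 < v) (c : ℝ) (j : Fin 4) {x : ℝ}
    (hx : x ∈ Icc (-1 : ℝ) 1) :
    HasDerivAt (llCoef v c j) (llCoefDeriv v c j x) x := by
  have hV := (regVar_pos hv c hx).ne'
  have hd := hasDerivAt_regVar v c x
  have hid := hasDerivAt_id x
  fin_cases j
  · refine ((hd.log hV).neg.div_const 2).congr_deriv ?_
    simp [llCoefDeriv]
    field_simp
  · refine ((((hid.pow 2).mul_const (c ^ 2)).neg).div (hd.const_mul 2)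
      (mul_ne_zero two_ne_zero hV)).congr_deriv ?_
    simp [llCoefDeriv]
    field_simp
  · refine ((hid.mul_const c).div hd hV).congr_deriv ?_
    simp [llCoefDeriv]
    field_simp
  · refine ((hasDerivAt_const x (-1 : ℝ)).div (hd.const_mul 2)
      (mul_ne_zero two_ne_zero hV)).congr_deriv ?_
    simp [llCoefDeriv]
    field_simp

lemma hasDerivAt_llCoefDeriv {v : ℝ} (hv : 0 < v) (c : ℝ) (j : Fin 4) {x : ℝ}
    (hx : x ∈ Icc (-1 : ℝ) 1) :
    HasDerivAt (llCoefDeriv v c j) (llCoefDeriv2 v c j x) x := by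
  have hV := (regVar_pos hv c hx).ne'
  have hd := hasDerivAt_regVar v c x
  have hid := hasDerivAt_id x
  fin_cases j
  · refine ((hid.mul_const (c ^ 2)).div hd hV).congr_deriv ?_
    simp [llCoefDeriv2]
    field_simp
  · refine (((hid.mul_const (c ^ 2)).neg.div hd hV).sub
      (((hid.pow 3).mul_const (c ^ 4)).div (hd.pow 2) (pow_ne_zero 2 hV))).congr_deriv ?_
    simp [llCoefDeriv2]
    field_simp
    ring
  · refine (((hasDerivAt_const x c).div hd hV).add
      ((((hid.pow 2).const_mul 2).mul_const (c ^ 3)).div (hd.pow 2)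
        (pow_ne_zero 2 hV))).congr_deriv ?_
    simp [llCoefDeriv2]
    field_simp
    ring
  · refine ((hid.mul_const (c ^ 2)).neg.div (hd.pow 2) (pow_ne_zero 2 hV)).congr_deriv ?_
    simp [llCoefDeriv2]
    field_simp
    ring

lemma continuousAt_llCoefDeriv2 {v : ℝ} (hv : 0 < v) (c : ℝ) (j : Fin 4) {x : ℝ}
    (hx : x ∈ Icc (-1 : ℝ) 1) :
    ContinuousAt (llCoefDeriv2 v c j) x := by
  have hV := (regVar_pos hv c hx).ne'
  have hc := (continuous_regVar v c).continuousAt (x := x)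
  fin_cases j
  all_goals
    simp only [llCoefDeriv2, Fin.zero_eta, Fin.mk_one, Fin.reduceFinMk, Matrix.cons_val]
    fun_prop (disch := simpa using hV)

/-- The expected log-likelihood of the regression is `-log V / 2` minus a normalised expected
squared error, `V` being the residual variance at the candidate correlation. -/
lemma sum_llMean_mul_llCoef (v c ρ x : ℝ) :
    ∑ j, llMean v c ρ j * llCoef v c j x = -Real.log (regVar v c x) / 2 -
      (regVar v c ρ + c ^ 2 * (x - ρ) ^ 2) / (2 * regVar v c x) := by
  have hρ : regVar v c ρ = v + (1 - ρ ^ 2) * c ^ 2 := rfl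
  simp only [llMean, llCoef, Fin.sum_univ_four, Matrix.cons_val, hρ]
  ring

lemma sum_llMean_mul_llCoef_le {v : ℝ} (hv : 0 < v) (c : ℝ) {ρ x : ℝ}
    (hρ : ρ ∈ Icc (-1 : ℝ) 1) (hx : x ∈ Icc (-1 : ℝ) 1) :
    ∑ j, llMean v c ρ j * llCoef v c j x + c ^ 2 * (x - ρ) ^ 2 / (2 * regVar v c x) ≤
      ∑ j, llMean v c ρ j * llCoef v c j ρ := by
  have hV := regVar_pos hv c hρ
  have hW := regVar_pos hv c hx
  have hlog := Real.log_le_sub_one_of_pos (div_pos hV hW)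
  rw [Real.log_div hV.ne' hW.ne'] at hlog
  rw [sum_llMean_mul_llCoef, sum_llMean_mul_llCoef]
  have h1 : (regVar v c ρ + c ^ 2 * (ρ - ρ) ^ 2) / (2 * regVar v c ρ) = 1 / 2 := by
    rw [sub_self]; field_simp; ring
  have h2 : (regVar v c ρ + c ^ 2 * (x - ρ) ^ 2) / (2 * regVar v c x) =
      regVar v c ρ / regVar v c x / 2 + c ^ 2 * (x - ρ) ^ 2 / (2 * regVar v c x) := by
    field_simp
  rw [h1, h2]
  linarith

lemma sum_llMean_mul_llCoefDeriv2 {v : ℝ} (hv : 0 < v) (c : ℝ) {ρ : ℝ}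
    (hρ : ρ ∈ Icc (-1 : ℝ) 1) :
    ∑ j, llMean v c ρ j * llCoefDeriv2 v c j ρ =
      -(c ^ 2 * (2 * ρ ^ 2 * c ^ 2 / regVar v c ρ ^ 2 + 1 / regVar v c ρ)) := by
  have hV := regVar_pos hv c hρ
  have hvV : v + c ^ 2 = regVar v c ρ + ρ ^ 2 * c ^ 2 := by rw [regVar]; ring
  simp only [llMean, llCoefDeriv2, Fin.sum_univ_four]
  simp only [Matrix.cons_val, hvV]
  field_simp
  ring

/-! ### Conditional independence and Gaussian residuals -/

/-- If the image of `κ a` under `g (a, ·)` is the same law `ν` for almost every `a`, then under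
`μ ⊗ₘ κ` the first coordinate is independent of `g`, and `g` has law `ν`. -/
lemma map_compProd_eq_prod {A B C : Type*} [MeasurableSpace A] [MeasurableSpace B]
    [MeasurableSpace C] {μ : Measure A} [IsFiniteMeasure μ] {κ : Kernel A B} [IsMarkovKernel κ]
    {g : A × B → C} (hg : Measurable g) {ν : Measure C} [IsProbabilityMeasure ν]
    (h : ∀ᵐ a ∂μ, (κ a).map (fun b => g (a, b)) = ν) :
    (μ ⊗ₘ κ).map (fun z => (z.1, g z)) = μ.prod ν := by
  have hm : Measurable fun z : A × B => (z.1, g z) := measurable_fst.prodMk hg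
  have : IsFiniteMeasure ((μ ⊗ₘ κ).map (fun z => (z.1, g z))) := inferInstance
  refine Measure.ext_prod fun {s t} hs ht => ?_
  rw [Measure.map_apply hm (hs.prod ht), Measure.prod_prod,
    Measure.compProd_apply (hm (hs.prod ht)), mul_comm, ← setLIntegral_const,
    ← lintegral_indicator hs]
  refine lintegral_congr_ae ?_
  filter_upwards [h] with a ha
  by_cases has : a ∈ s
  · rw [indicator_of_mem has, ← ha, Measure.map_apply (f := fun b => g (a, b))
      (hg.comp measurable_prodMk_left) ht]
    congr 1
    ext b
    simp [has]
  · rw [indicator_of_notMem has]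
    have : Prod.mk a ⁻¹' ((fun z : A × B => (z.1, g z)) ⁻¹' s ×ˢ t) = ∅ := by
      ext b
      simp [has]
    rw [this, measure_empty]

/-- A function of `(V, W)` whose conditional law given `V` does not depend on `V` is independent of
`V`, and its law is that common conditional law. -/
lemma indepFun_and_map_of_shear {Ω A B C : Type*} [MeasurableSpace Ω] [MeasurableSpace A]
    [MeasurableSpace B] [MeasurableSpace C] {P : Measure Ω} [IsProbabilityMeasure P]
    {V : Ω → A} {W : Ω → B} (hV : Measurable V) (hW : Measurable W) {κ : Kernel A B}
    [IsMarkovKernel κ] (hκ : P.map (fun ω => (V ω, W ω)) = P.map V ⊗ₘ κ)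
    {g : A × B → C} (hg : Measurable g) {ν : Measure C} [IsProbabilityMeasure ν]
    (h : ∀ᵐ a ∂(P.map V), (κ a).map (fun b => g (a, b)) = ν) :
    V ⟂ᵢ[P] (fun ω => g (V ω, W ω)) ∧ P.map (fun ω => g (V ω, W ω)) = ν := by
  have : IsProbabilityMeasure (P.map V) := Measure.isProbabilityMeasure_map hV.aemeasurable
  have hgm : Measurable fun ω => g (V ω, W ω) := hg.comp (hV.prodMk hW)
  have h1 : P.map (fun ω => (V ω, g (V ω, W ω))) = (P.map V).prod ν := by
    rw [← map_compProd_eq_prod hg h, ← hκ, Measure.map_map (measurable_fst.prodMk hg)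
      (hV.prodMk hW)]
    rfl
  have h2 : P.map (fun ω => g (V ω, W ω)) = ν := by
    have := congrArg Measure.snd h1
    rwa [Measure.snd_map_prodMk hV, Measure.snd_prod] at this
  refine ⟨?_, h2⟩
  rw [indepFun_iff_map_prod_eq_prod_map_map hV.aemeasurable hgm.aemeasurable, h1, h2]

/-- Under conditional independence `V ⫫ W | Z`, the conditional law of `W` given `(Z, V)` is that
given `Z` alone. -/
lemma CondIndepGiven.map_eq_compProd {Ω A B C : Type*} [MeasurableSpace Ω] [MeasurableSpace A]
    [mB : MeasurableSpace B] [StandardBorelSpace B] [Nonempty B] [mC : MeasurableSpace C]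
    {P : Measure Ω} [IsProbabilityMeasure P] {V : Ω → A} {W : Ω → B} {Z : Ω → C}
    (hV : Measurable V) (hW : Measurable W) (hZ : Measurable Z)
    (h : CondIndepGiven V W Z P) :
    P.map (fun ω => ((Z ω, V ω), W ω)) =
      P.map (fun ω => (Z ω, V ω)) ⊗ₘ (condDistrib W Z P).comap Prod.fst measurable_fst := by
  have hm := hZ.comap_le
  have : IsFiniteMeasure (P.map (fun ω => ((Z ω, V ω), W ω))) := inferInstance
  refine Measure.ext_prod₃' fun {s t u} hs ht hu => ?_
  rw [Measure.map_apply ((hZ.prodMk hV).prodMk hW) ((hs.prod ht).prod hu),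
    Measure.compProd_apply_prod (hs.prod ht) hu,
    setLIntegral_map (hs.prod ht) (Kernel.measurable_coe _ hu) (hZ.prodMk hV)]
  simp only [Kernel.comap_apply]
  set κ := condDistrib W Z P with hκ
  set q : Ω → ℝ := fun ω => (κ (Z ω)).real u with hq
  have hqm : StronglyMeasurable[mC.comap Z] q := by
    have h1 : Measurable fun z => (κ z).real u := (Kernel.measurable_coe κ hu).ennreal_toReal
    exact (h1.comp (comap_measurable Z)).stronglyMeasurable
  have hq1 : ∀ ω, ‖q ω‖ ≤ 1 := fun ω => by
    rw [Real.norm_of_nonneg measureReal_nonneg]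
    exact measureReal_le_one
  have hVt : MeasurableSet (V ⁻¹' t) := hV ht
  have hWu : MeasurableSet (W ⁻¹' u) := hW hu
  have hint1 : Integrable ((V ⁻¹' t).indicator fun _ => (1 : ℝ)) P :=
    (integrable_const 1).indicator hVt
  have hint2 : Integrable ((V ⁻¹' t).indicator (fun _ => (1 : ℝ)) * q) P :=
    hint1.mul_bdd (c := 1) (hqm.mono hm).aestronglyMeasurable (Eventually.of_forall hq1)
  -- `P(V ∈ t, W ∈ u | Z) = P(V ∈ t | Z) κ(Z, u) = E[1_{V ∈ t} κ(Z, u) | Z]`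
  have hce : P⟦V ⁻¹' t ∩ W ⁻¹' u | mC.comap Z⟧ =ᵐ[P]
      P[(V ⁻¹' t).indicator (fun _ => (1 : ℝ)) * q | mC.comap Z] := by
    refine (h t u ht hu).trans ?_
    refine EventuallyEq.trans ?_ (condExp_mul_of_stronglyMeasurable_right hqm hint2 hint1).symm
    filter_upwards [condDistrib_ae_eq_condExp (μ := P) hZ hW hu] with ω hω
    rw [Pi.mul_apply, ← hω]
  have hset : MeasurableSet[mC.comap Z] (Z ⁻¹' s) := ⟨s, hs, rfl⟩
  have hI : ∫ ω in Z ⁻¹' s, (V ⁻¹' t ∩ W ⁻¹' u).indicator (fun _ => (1 : ℝ)) ω ∂P =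
      ∫ ω in Z ⁻¹' s, ((V ⁻¹' t).indicator (fun _ => (1 : ℝ)) * q) ω ∂P := by
    rw [← setIntegral_condExp hm ((integrable_const 1).indicator (hVt.inter hWu)) hset,
      ← setIntegral_condExp hm hint2 hset]
    exact integral_congr_ae (ae_restrict_of_ae hce)
  rw [← ENNReal.toReal_eq_toReal_iff' (measure_ne_top _ _)]
  · rw [← integral_toReal]
    · have e1 : ((fun ω => ((Z ω, V ω), W ω)) ⁻¹' (s ×ˢ t) ×ˢ u) =
          (Z ⁻¹' s) ∩ (V ⁻¹' t ∩ W ⁻¹' u) := by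
        ext ω; simp [and_assoc]
      have e2 : (fun ω => (Z ω, V ω)) ⁻¹' (s ×ˢ t) = Z ⁻¹' s ∩ V ⁻¹' t := by
        ext ω; simp
      have e3 : (V ⁻¹' t).indicator (fun _ => (1 : ℝ)) * q = (V ⁻¹' t).indicator q := by
        ext ω
        by_cases hω : ω ∈ V ⁻¹' t <;> simp [hω]
      rw [e3, setIntegral_indicator (hVt.inter hWu), setIntegral_indicator hVt] at hI
      rw [e1, e2]
      simpa [Measure.real, hq] using hI
    · exact ((Kernel.measurable_coe κ hu).comp hZ).aemeasurable
    · exact Eventually.of_forall fun ω => measure_lt_top _ _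
  · refine ((setLIntegral_mono measurable_const (g := fun _ => 1) fun ω _ => prob_le_one).trans_lt
      ?_).ne
    simp

lemma CondIndepGiven.of_snd {Ω A B B' C : Type*} [MeasurableSpace Ω] [MeasurableSpace A]
    [MeasurableSpace B] [MeasurableSpace B'] [MeasurableSpace C] {P : Measure Ω} {V : Ω → A}
    {W : Ω → B} {W' : Ω → B'} {Z : Ω → C}
    (h : CondIndepGiven V (fun ω => (W ω, W' ω)) Z P) : CondIndepGiven V W Z P := by
  intro a b ha hb
  have := h a (b ×ˢ univ) ha (hb.prod MeasurableSet.univ)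
  rwa [show (fun ω => (W ω, W' ω)) ⁻¹' b ×ˢ univ = W ⁻¹' b by ext; simp] at this

lemma multivariateGaussian_map_sub {ι : Type*} [Fintype ι] [DecidableEq ι]
    (m : EuclideanSpace ℝ ι) (S : Matrix ι ι ℝ) :
    (multivariateGaussian m S).map (fun u => u - m) = multivariateGaussian 0 S := by
  unfold multivariateGaussian
  rw [Measure.map_map (by fun_prop) (by fun_prop)]
  congr 1
  ext u
  simp

lemma Params.measurable_meanS (θ : Params p) : Measurable θ.meanS := by
  unfold Params.meanS dotProduct
  fun_prop

lemma Params.measurable_meanY (θ : Params p) :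
    Measurable fun z : EuclideanSpace ℝ (Fin 2) × (Fin p → ℝ) × Fin 2 =>
      θ.meanY z.2.2 z.1 z.2.1 := by
  have : Measurable fun z : (EuclideanSpace ℝ (Fin 2) × (Fin p → ℝ)) × Fin 2 =>
      θ.meanY z.2 z.1.1 z.1.2 := by
    refine measurable_from_prod_countable_left fun t => ?_
    unfold Params.meanY dotProduct
    fun_prop
  exact this.comp (by fun_prop : Measurable fun z : EuclideanSpace ℝ (Fin 2) × (Fin p → ℝ) × Fin 2
    => ((z.1, z.2.1), z.2.2))

lemma measurable_eval_fin {Ω : Type*} [MeasurableSpace Ω] {g : Ω → Fin 2 → ℝ} {T : Ω → Fin 2}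
    (hg : Measurable g) (hT : Measurable T) : Measurable fun ω => g ω (T ω) := by
  have : Measurable fun z : (Fin 2 → ℝ) × Fin 2 => z.1 z.2 :=
    measurable_from_prod_countable_left fun t => measurable_pi_apply t
  exact this.comp (hg.prodMk hT)

lemma Params.posSemidef_covS (θ : Params p) {ρ : ℝ} (hρ : ρ ∈ Ioo (-1 : ℝ) 1) :
    (θ.covS ρ).PosSemidef := by
  refine Matrix.PosSemidef.of_dotProduct_mulVec_nonneg ?_ fun x => ?_
  · ext i j
    fin_cases i <;> fin_cases j <;> simp [Params.covS]
  · have h1 : 0 ≤ 1 - ρ ^ 2 := by nlinarith [hρ.1, hρ.2]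
    have h2 : star x ⬝ᵥ (θ.covS ρ *ᵥ x) = (θ.σs 0 * x 0 + ρ * θ.σs 1 * x 1) ^ 2 +
        (1 - ρ ^ 2) * (θ.σs 1 * x 1) ^ 2 := by
      simp [Params.covS, dotProduct, Matrix.mulVec, Fin.sum_univ_two]
      ring
    rw [h2]
    positivity

section Sample

variable {Ω : Type*} [MeasurableSpace Ω] {P : Measure Ω} [IsProbabilityMeasure P]
  {θ : Params p} {ρ : ℝ} {X : ℕ → Ω → Fin p → ℝ} {T : ℕ → Ω → Fin 2}
  {U : ℕ → Ω → EuclideanSpace ℝ (Fin 2)} {Y : ℕ → Ω → Fin 2 → ℝ}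

/-- The centred potential intermediates are Gaussian and independent of covariates and
treatment. -/
lemma IsModelSample.centred_U (h : IsModelSample P θ ρ X T U Y) (i : ℕ) :
    (fun ω => (X i ω, T i ω)) ⟂ᵢ[P] (fun ω => U i ω - θ.meanS (X i ω)) ∧
      P.map (fun ω => U i ω - θ.meanS (X i ω)) = multivariateGaussian 0 (θ.covS ρ) := by
  have hX := h.measurable_X i
  have hT := h.measurable_T i
  have hU := h.measurable_U i
  refine indepFun_and_map_of_shear (V := fun ω => (X i ω, T i ω)) (hX.prodMk hT) hU
    ((h.ignorability i).of_snd.map_eq_compProd hT hU hX)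
    (g := fun z => z.2 - θ.meanS z.1.1) ?_ ?_
  · have := θ.measurable_meanS
    fun_prop
  · have hpull : ∀ᵐ a ∂(P.map fun ω => (X i ω, T i ω)),
        condDistrib (U i) (X i) P a.1 = multivariateGaussian (θ.meanS a.1) (θ.covS ρ) := by
      have hm := h.model_U i
      have e : P.map (X i) = (P.map fun ω => (X i ω, T i ω)).map Prod.fst := by
        rw [Measure.map_map measurable_fst (hX.prodMk hT)]
        rfl
      rw [e] at hm
      exact ae_of_ae_map measurable_fst.aemeasurable hm
    filter_upwards [hpull] with a ha
    rw [Kernel.comap_apply, ha]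
    exact multivariateGaussian_map_sub _ _

/-- The outcome noise is Gaussian and independent of intermediates, covariates and treatment. -/
lemma IsModelSample.centred_Y (h : IsModelSample P θ ρ X T U Y) (i : ℕ) :
    (fun ω => (U i ω, X i ω, T i ω)) ⟂ᵢ[P]
        (fun ω => Y i ω (T i ω) - θ.meanY (T i ω) (U i ω) (X i ω)) ∧
      P.map (fun ω => Y i ω (T i ω) - θ.meanY (T i ω) (U i ω) (X i ω)) =
        gaussianReal 0 (Real.toNNReal (θ.σy ^ 2)) := by
  have hX := h.measurable_X i
  have hT := h.measurable_T i
  have hU := h.measurable_U i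
  have hY := measurable_eval_fin (h.measurable_Y i) hT
  have hV : Measurable fun ω => (U i ω, X i ω, T i ω) := hU.prodMk (hX.prodMk hT)
  refine indepFun_and_map_of_shear (V := fun ω => (U i ω, X i ω, T i ω)) hV hY
    (compProd_map_condDistrib hY.aemeasurable).symm
    (g := fun z => z.2 - θ.meanY z.1.2.2 z.1.1 z.1.2.1) ?_ ?_
  · exact measurable_snd.sub (θ.measurable_meanY.comp measurable_fst)
  · filter_upwards [h.model_Y i] with a ha
    rw [ha, gaussianReal_map_sub_const, sub_self]

end Sample

/-! ### Sufficient statistics and the strong law -/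

/-- The `j`-th sufficient statistic of a unit in treatment arm `t`: zero for units in the other
arm, otherwise `llStat` of the standardised intermediate and the residual. -/
def armStat (θ : Params p) (t : Fin 2) (j : Fin 4) (x : Fin p → ℝ) (τ : Fin 2) (s y : ℝ) : ℝ :=
  if τ = t then llStat (θ.stdS x t s) (θ.residual x t s y) j else 0

lemma sum_armStat_mul (θ : Params p) (x : Fin p → ℝ) (τ : Fin 2) (s y : ℝ)
    (g : Fin 2 → Fin 4 → ℝ) :
    ∑ k : Fin 2 × Fin 4, armStat θ k.1 k.2 x τ s y * g k.1 k.2 =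
      ∑ j, llStat (θ.stdS x τ s) (θ.residual x τ s y) j * g τ j := by
  rw [Fintype.sum_prod_type, Finset.sum_eq_single τ]
  · simp [armStat]
  · intro t _ ht
    simp [armStat, ht.symm]
  · simp

lemma measurable_armStat (θ : Params p) (t : Fin 2) (j : Fin 4) :
    Measurable fun z : (Fin p → ℝ) × Fin 2 × EuclideanSpace ℝ (Fin 2) × (Fin 2 → ℝ) =>
      armStat θ t j z.1 z.2.1 (z.2.2.1 z.2.1) (z.2.2.2 z.2.1) := by
  have e : (fun z : (Fin p → ℝ) × Fin 2 × EuclideanSpace ℝ (Fin 2) × (Fin 2 → ℝ) =>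
      armStat θ t j z.1 z.2.1 (z.2.2.1 z.2.1) (z.2.2.2 z.2.1)) = fun z =>
      if z.2.1 = t then llStat (θ.stdS z.1 t (z.2.2.1 t)) (θ.residual z.1 t (z.2.2.1 t)
        (z.2.2.2 t)) j else 0 := by
    ext z
    unfold armStat
    split_ifs with h
    · rw [h]
    · rfl
  rw [e]
  have hm := θ.measurable_meanS
  have h1 : Measurable fun z : (Fin p → ℝ) × Fin 2 × EuclideanSpace ℝ (Fin 2) × (Fin 2 → ℝ) =>
      θ.stdS z.1 t (z.2.2.1 t) := by
    unfold Params.stdS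
    fun_prop
  have h2 : Measurable fun z : (Fin p → ℝ) × Fin 2 × EuclideanSpace ℝ (Fin 2) × (Fin 2 → ℝ) =>
      θ.residual z.1 t (z.2.2.1 t) (z.2.2.2 t) := by
    unfold Params.residual
    have : Measurable fun z : (Fin p → ℝ) × Fin 2 × EuclideanSpace ℝ (Fin 2) × (Fin 2 → ℝ) =>
        θ.γ ⬝ᵥ z.1 := by
      unfold dotProduct
      fun_prop
    fun_prop
  refine Measurable.ite ?_ ?_ measurable_const
  · exact (measurable_fst.comp measurable_snd) (measurableSet_singleton t)
  · fin_cases j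
    · exact measurable_const
    · exact h1.pow_const 2
    · exact h1.mul h2
    · exact h2.pow_const 2

lemma stdS_eq_centred (θ : Params p) (x : Fin p → ℝ) (t : Fin 2) (u : EuclideanSpace ℝ (Fin 2)) :
    θ.stdS x t (u t) = (u - θ.meanS x) t / θ.σs t := rfl

lemma residual_eq_centred (θ : Params p) (x : Fin p → ℝ) (t : Fin 2)
    (u : EuclideanSpace ℝ (Fin 2)) (y : ℝ) :
    θ.residual x t (u t) y = (y - θ.meanY t u x) + θ.β t (1 - t) * (u - θ.meanS x) (1 - t) := by
  fin_cases t
  · simp [Params.residual, Params.meanY, Fin.sum_univ_two]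
    ring
  · simp [Params.residual, Params.meanY, Fin.sum_univ_two]
    ring

/-- Second moments of a centred Gaussian vector. -/
lemma moments_of_map_multivariateGaussian {Ω : Type*} [MeasurableSpace Ω] {P : Measure Ω}
    {W : Ω → EuclideanSpace ℝ (Fin 2)} (hW : Measurable W)
    {S : Matrix (Fin 2) (Fin 2) ℝ} (hS : S.PosSemidef)
    (h : P.map W = multivariateGaussian 0 S) (j k : Fin 2) :
    MemLp (fun ω => W ω j) 2 P ∧ ∫ ω, W ω j * W ω k ∂P = S j k := by
  have hcoord : ∀ l : Fin 2, MemLp (fun u : EuclideanSpace ℝ (Fin 2) => u l) 2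
      (multivariateGaussian 0 S) := fun l =>
    (EuclideanSpace.proj (𝕜 := ℝ) l).comp_memLp' IsGaussian.memLp_two_id
  have hmean : ∀ l : Fin 2,
      ∫ u, u l ∂(multivariateGaussian (0 : EuclideanSpace ℝ (Fin 2)) S) = 0 := by
    intro l
    have := (EuclideanSpace.proj (𝕜 := ℝ) l).integral_comp_comm
      (IsGaussian.integrable_fun_id (μ := multivariateGaussian (0 : EuclideanSpace ℝ (Fin 2)) S))
    rw [integral_id_multivariateGaussian] at this
    simpa using this
  constructor
  · have := hcoord j
    rw [← h] at this
    exact this.comp_of_map hW.aemeasurable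
  · have hc := covariance_eval_multivariateGaussian (μ := 0) hS j k
    rw [covariance_eq_sub (hcoord j) (hcoord k), hmean, zero_mul, sub_zero, ← h,
      integral_map hW.aemeasurable (by fun_prop)] at hc
    exact hc

/-- Moments of a centred Gaussian random variable. -/
lemma moments_of_map_gaussianReal {Ω : Type*} [MeasurableSpace Ω] {P : Measure Ω} {ε : Ω → ℝ}
    (hε : Measurable ε) {v : NNReal} (h : P.map ε = gaussianReal 0 v) :
    MemLp ε 2 P ∧ ∫ ω, ε ω ∂P = 0 ∧ ∫ ω, ε ω * ε ω ∂P = v := by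
  refine ⟨?_, ?_, ?_⟩
  · have := memLp_id_gaussianReal (μ := 0) (v := v) 2
    rw [← h] at this
    exact this.comp_of_map hε.aemeasurable
  · have := integral_id_gaussianReal (μ := 0) (v := v)
    rwa [← h, integral_map hε.aemeasurable (by fun_prop)] at this
  · have h1 := variance_fun_id_gaussianReal (μ := 0) (v := v)
    rw [variance_eq_integral (by fun_prop), ← h, integral_map hε.aemeasurable (by fun_prop),
      integral_map hε.aemeasurable (by fun_prop)] at h1
    have h2 := integral_id_gaussianReal (μ := 0) (v := v)
    rw [← h, integral_map hε.aemeasurable (by fun_prop)] at h2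
    rw [h2] at h1
    simpa [sq] using h1

lemma integral_pos_of_ae_pos {Ω : Type*} [MeasurableSpace Ω] {P : Measure Ω}
    [IsProbabilityMeasure P] {g : Ω → ℝ} (hg : Integrable g P) (h : ∀ᵐ ω ∂P, 0 < g ω) :
    0 < ∫ ω, g ω ∂P := by
  have h0 : 0 ≤ᵐ[P] g := h.mono fun ω hω => hω.le
  refine lt_of_le_of_ne (integral_nonneg_of_ae h0) fun he => ?_
  have hz := (integral_eq_zero_iff_of_nonneg_ae h0 hg).1 he.symm
  obtain ⟨ω, h1, h2⟩ := (h.and hz).exists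
  exact h1.ne' h2

section Sample

variable {Ω : Type*} [MeasurableSpace Ω] {P : Measure Ω} [IsProbabilityMeasure P]
  {θ : Params p} {ρ : ℝ} {X : ℕ → Ω → Fin p → ℝ} {T : ℕ → Ω → Fin 2}
  {U : ℕ → Ω → EuclideanSpace ℝ (Fin 2)} {Y : ℕ → Ω → Fin 2 → ℝ}

/-- Each arm statistic is integrable, with mean the arm probability times the moment under the
Gaussian regression model. -/
lemma IsModelSample.integral_armStat (h : IsModelSample P θ ρ X T U Y) (hσs : ∀ t, 0 < θ.σs t)
    (hρ : ρ ∈ Ioo (-1 : ℝ) 1) (i : ℕ) (t : Fin 2) (j : Fin 4) :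
    Integrable (fun ω => armStat θ t j (X i ω) (T i ω) (U i ω (T i ω)) (Y i ω (T i ω))) P ∧
      ∫ ω, armStat θ t j (X i ω) (T i ω) (U i ω (T i ω)) (Y i ω (T i ω)) ∂P =
        P.real (T i ⁻¹' {t}) * llMean (θ.σy ^ 2) (θ.cross t) ρ j := by
  have hX := h.measurable_X i
  have hT := h.measurable_T i
  have hU := h.measurable_U i
  have hYT := measurable_eval_fin (h.measurable_Y i) hT
  obtain ⟨hWind, hWlaw⟩ := h.centred_U i
  obtain ⟨hεind, hεlaw⟩ := h.centred_Y i
  set W : Ω → EuclideanSpace ℝ (Fin 2) := fun ω => U i ω - θ.meanS (X i ω) with hWdef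
  set ε : Ω → ℝ := fun ω => Y i ω (T i ω) - θ.meanY (T i ω) (U i ω) (X i ω) with hεdef
  have hWm : Measurable W := hU.sub (θ.measurable_meanS.comp hX)
  have hεm : Measurable ε :=
    hYT.sub (θ.measurable_meanY.comp (hU.prodMk (hX.prodMk hT)))
  have hWmom := moments_of_map_multivariateGaussian hWm (θ.posSemidef_covS hρ) hWlaw
  obtain ⟨hε2, hε0, hεv⟩ := moments_of_map_gaussianReal hεm hεlaw
  rw [Real.coe_toNNReal _ (sq_nonneg _)] at hεv
  -- the arm indicator, as a function of the treatment
  set d : Fin 2 → ℝ := fun τ => if τ = t then 1 else 0 with hd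
  have hdm : Measurable d := measurable_of_countable d
  have hD : ∫ ω, d (T i ω) ∂P = P.real (T i ⁻¹' {t}) := by
    have : (fun ω => d (T i ω)) = (T i ⁻¹' {t}).indicator (fun _ => (1 : ℝ)) := by
      ext ω
      by_cases hω : T i ω = t <;> simp [hd, hω]
    rw [this, integral_indicator (hT (measurableSet_singleton t))]
    simp
  have hDint : Integrable (fun ω => d (T i ω)) P := by
    refine Integrable.of_bound (hdm.comp hT).aestronglyMeasurable 1
      (Eventually.of_forall fun ω => ?_)
    simp only [hd]
    split_ifs <;> simp
  have hWW : ∀ a b : Fin 2, Integrable (fun ω => d (T i ω) * (W ω a * W ω b)) P ∧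
      ∫ ω, d (T i ω) * (W ω a * W ω b) ∂P = P.real (T i ⁻¹' {t}) * θ.covS ρ a b := by
    intro a b
    have hind : (fun ω => d (T i ω)) ⟂ᵢ[P] (fun ω => W ω a * W ω b) :=
      hWind.comp (φ := fun z : (Fin p → ℝ) × Fin 2 => d z.2)
        (ψ := fun u : EuclideanSpace ℝ (Fin 2) => u a * u b)
        (hdm.comp measurable_snd) (by fun_prop)
    refine ⟨hind.integrable_mul hDint ((hWmom a a).1.integrable_mul (hWmom b b).1), ?_⟩
    rw [hind.integral_fun_mul_eq_mul_integral hDint.aestronglyMeasurable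
      ((hWmom a a).1.integrable_mul (hWmom b b).1).aestronglyMeasurable, hD, (hWmom a b).2]
  have hεε : Integrable (fun ω => d (T i ω) * (ε ω * ε ω)) P ∧
      ∫ ω, d (T i ω) * (ε ω * ε ω) ∂P = P.real (T i ⁻¹' {t}) * θ.σy ^ 2 := by
    have hind : (fun ω => d (T i ω)) ⟂ᵢ[P] (fun ω => ε ω * ε ω) :=
      hεind.comp (φ := fun z : EuclideanSpace ℝ (Fin 2) × (Fin p → ℝ) × Fin 2 => d z.2.2)
        (ψ := fun e : ℝ => e * e)
        (hdm.comp (measurable_snd.comp measurable_snd)) (by fun_prop)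
    refine ⟨hind.integrable_mul hDint (hε2.integrable_mul hε2), ?_⟩
    rw [hind.integral_fun_mul_eq_mul_integral hDint.aestronglyMeasurable
      (hε2.integrable_mul hε2).aestronglyMeasurable, hD, hεv]
  have hWε : ∀ a : Fin 2, Integrable (fun ω => d (T i ω) * W ω a * ε ω) P ∧
      ∫ ω, d (T i ω) * W ω a * ε ω ∂P = 0 := by
    intro a
    have hφ : Measurable fun z : EuclideanSpace ℝ (Fin 2) × (Fin p → ℝ) × Fin 2 =>
        d z.2.2 * (z.1 - θ.meanS z.2.1) a := by
      have := θ.measurable_meanS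
      have h1 : Measurable fun z : EuclideanSpace ℝ (Fin 2) × (Fin p → ℝ) × Fin 2 => d z.2.2 :=
        hdm.comp (measurable_snd.comp measurable_snd)
      fun_prop
    have hind : (fun ω => d (T i ω) * W ω a) ⟂ᵢ[P] ε := hεind.comp hφ measurable_id
    have hind' : (fun ω => d (T i ω)) ⟂ᵢ[P] (fun ω => W ω a) :=
      hWind.comp (φ := fun z : (Fin p → ℝ) × Fin 2 => d z.2)
        (ψ := fun u : EuclideanSpace ℝ (Fin 2) => u a)
        (hdm.comp measurable_snd) (by fun_prop)
    have hint : Integrable (fun ω => d (T i ω) * W ω a) P :=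
      hind'.integrable_mul hDint ((hWmom a a).1.integrable one_le_two)
    refine ⟨hind.integrable_mul hint (hε2.integrable one_le_two), ?_⟩
    rw [hind.integral_fun_mul_eq_mul_integral hint.aestronglyMeasurable
      hε2.1, hε0, mul_zero]
  have hσ := (hσs t).ne'
  set b := θ.β t (1 - t) with hb
  have hcov1 : θ.covS ρ t t = θ.σs t ^ 2 := by fin_cases t <;> simp [Params.covS]
  have hcov2 : θ.covS ρ (1 - t) (1 - t) = θ.σs (1 - t) ^ 2 := by
    fin_cases t <;> simp [Params.covS]
  have hcov3 : θ.covS ρ t (1 - t) = ρ * θ.σs t * θ.σs (1 - t) := by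
    fin_cases t <;> simp [Params.covS]
    ring
  have hrepr : ∀ ω, armStat θ t j (X i ω) (T i ω) (U i ω (T i ω)) (Y i ω (T i ω)) =
      d (T i ω) * llStat (W ω t / θ.σs t) (ε ω + b * W ω (1 - t)) j := by
    intro ω
    by_cases hTt : T i ω = t
    · simp only [armStat, hd, if_pos hTt, one_mul]
      rw [hTt, stdS_eq_centred, residual_eq_centred]
      simp only [hWdef, hεdef, hTt, hb]
    · simp [armStat, hd, hTt]
  simp_rw [hrepr]
  fin_cases j
  · have e : ∀ ω, d (T i ω) * llStat (W ω t / θ.σs t) (ε ω + b * W ω (1 - t)) 0 =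
        d (T i ω) := fun ω => by simp [llStat]
    simp only [Fin.zero_eta, e, llMean, Matrix.cons_val]
    exact ⟨hDint, by rw [hD, mul_one]⟩
  · have e : ∀ ω, d (T i ω) * llStat (W ω t / θ.σs t) (ε ω + b * W ω (1 - t)) 1 =
        (θ.σs t ^ 2)⁻¹ * (d (T i ω) * (W ω t * W ω t)) := fun ω => by
      simp only [llStat, Matrix.cons_val]
      field_simp
    simp only [Fin.mk_one, e, llMean, Matrix.cons_val]
    refine ⟨(hWW t t).1.const_mul _, ?_⟩
    rw [integral_const_mul, (hWW t t).2, hcov1]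
    field_simp
  · have e : ∀ ω, d (T i ω) * llStat (W ω t / θ.σs t) (ε ω + b * W ω (1 - t)) 2 =
        (θ.σs t)⁻¹ * (d (T i ω) * W ω t * ε ω) +
          b / θ.σs t * (d (T i ω) * (W ω t * W ω (1 - t))) := fun ω => by
      simp only [llStat, Matrix.cons_val]
      field_simp
    simp only [Fin.reduceFinMk, e, llMean, Matrix.cons_val]
    have i1 := (hWε t).1.const_mul (θ.σs t)⁻¹
    have i2 := (hWW t (1 - t)).1.const_mul (b / θ.σs t)
    refine ⟨i1.add i2, ?_⟩
    rw [integral_add i1 i2, integral_const_mul, integral_const_mul, (hWε t).2,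
      (hWW t (1 - t)).2, hcov3, Params.cross]
    field_simp
    ring
  · have e : ∀ ω, d (T i ω) * llStat (W ω t / θ.σs t) (ε ω + b * W ω (1 - t)) 3 =
        d (T i ω) * (ε ω * ε ω) + 2 * b * (d (T i ω) * W ω (1 - t) * ε ω) +
          b ^ 2 * (d (T i ω) * (W ω (1 - t) * W ω (1 - t))) := fun ω => by
      simp only [llStat, Matrix.cons_val]
      ring
    simp only [Fin.reduceFinMk, e, llMean, Matrix.cons_val]
    have i1 := hεε.1
    have i2 := (hWε (1 - t)).1.const_mul (2 * b)
    have i3 := (hWW (1 - t) (1 - t)).1.const_mul (b ^ 2)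
    have i12 : Integrable (fun ω => d (T i ω) * (ε ω * ε ω) +
        2 * b * (d (T i ω) * W ω (1 - t) * ε ω)) P := i1.add i2
    refine ⟨i12.add i3, ?_⟩
    rw [integral_add i12 i3, integral_add i1 i2, integral_const_mul, integral_const_mul,
      hεε.2, (hWε (1 - t)).2, (hWW (1 - t) (1 - t)).2, hcov2, Params.cross]
    ring

/-- Strong law for the sufficient statistics. -/
lemma IsModelSample.tendsto_average_armStat (h : IsModelSample P θ ρ X T U Y)
    (hσs : ∀ t, 0 < θ.σs t) (hρ : ρ ∈ Ioo (-1 : ℝ) 1) :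
    ∀ᵐ ω ∂P, Tendsto (fun (n : ℕ) (k : Fin 2 × Fin 4) => (∑ i ∈ Finset.range n,
        armStat θ k.1 k.2 (X i ω) (T i ω) (U i ω (T i ω)) (Y i ω (T i ω))) / n) atTop
      (𝓝 fun k => P.real (T 0 ⁻¹' {k.1}) * llMean (θ.σy ^ 2) (θ.cross k.1) ρ k.2) := by
  simp_rw [tendsto_pi_nhds]
  rw [ae_all_iff]
  rintro ⟨t, j⟩
  have hm := measurable_armStat θ t j
  obtain ⟨hint, hval⟩ := h.integral_armStat hσs hρ 0 t j
  have := strong_law_ae_real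
    (fun i ω => armStat θ t j (X i ω) (T i ω) (U i ω (T i ω)) (Y i ω (T i ω))) hint
    (fun i k hik => (h.indep.indepFun hik).comp hm hm) (fun i => (h.ident i).comp hm)
  simp only [hval] at this
  exact this

lemma IsModelSample.arm_prob_zero (h : IsModelSample P θ ρ X T U Y) :
    P.real (T 0 ⁻¹' {0}) = 1 - P.real (T 0 ⁻¹' {1}) := by
  rw [← probReal_compl_eq_one_sub (h.measurable_T 0 (measurableSet_singleton 1))]
  congr 1
  ext ω
  simp only [mem_preimage, mem_singleton_iff, mem_compl_iff]
  generalize T 0 ω = τ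
  fin_cases τ <;> simp

/-- Both treatment arms have positive probability. -/
lemma IsModelSample.arm_prob_pos (h : IsModelSample P θ ρ X T U Y) (t : Fin 2) :
    0 < P.real (T 0 ⁻¹' {t}) := by
  have hT := h.measurable_T 0
  have hm := (h.measurable_X 0).comap_le
  set g := P⟦T 0 ⁻¹' {1} | MeasurableSpace.comap (X 0) inferInstance⟧ with hg
  have hgint : Integrable g P := integrable_condExp
  have hI : ∫ ω, g ω ∂P = P.real (T 0 ⁻¹' {1}) := by
    rw [hg, integral_condExp hm, integral_indicator (hT (measurableSet_singleton 1))]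
    simp
  have h1 : 0 < P.real (T 0 ⁻¹' {1}) := by
    rw [← hI]
    exact integral_pos_of_ae_pos hgint ((h.positivity 0).mono fun ω hω => hω.1)
  have h2 : P.real (T 0 ⁻¹' {1}) < 1 := by
    have := integral_pos_of_ae_pos ((integrable_const (1 : ℝ)).sub hgint)
      ((h.positivity 0).mono fun ω hω => sub_pos.2 hω.2)
    simp only [Pi.sub_apply] at this
    rw [integral_sub (integrable_const _) hgint, hI] at this
    simpa using this
  fin_cases t
  · simp only [Fin.zero_eta, h.arm_prob_zero]
    linarith
  · exact h1

end Sample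

/-! ### Posterior variance and information -/

/-- Variance of the normalisation of a density `g = C k` on `(-1, 1)`, through the moments of `k`
about an arbitrary centre `a`. -/
lemma variance_normalized_withDensity {g k : ℝ → ℝ} {C : ℝ} (hC : 0 < C) (a : ℝ)
    (hgk : ∀ x ∈ Ioo (-1 : ℝ) 1, g x = C * k x) (hk0 : ∀ x ∈ Ioo (-1 : ℝ) 1, 0 ≤ k x)
    (hk : IntegrableOn k (Ioo (-1 : ℝ) 1)) (hpos : 0 < ∫ x in Ioo (-1 : ℝ) 1, k x) :
    Var[id; (((volume.restrict (Ioo (-1 : ℝ) 1)).withDensity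
        fun x => ENNReal.ofReal (g x)) univ)⁻¹ •
        (volume.restrict (Ioo (-1 : ℝ) 1)).withDensity fun x => ENNReal.ofReal (g x)] =
      (∫ x in Ioo (-1 : ℝ) 1, k x * (x - a) ^ 2) / (∫ x in Ioo (-1 : ℝ) 1, k x) -
        ((∫ x in Ioo (-1 : ℝ) 1, k x * (x - a)) / (∫ x in Ioo (-1 : ℝ) 1, k x)) ^ 2 := by
  set m := volume.restrict (Ioo (-1 : ℝ) 1) with hm
  have hden : m.withDensity (fun x => ENNReal.ofReal (g x)) =
      m.withDensity (fun x => ENNReal.ofReal (C * k x)) := by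
    refine withDensity_congr_ae ?_
    filter_upwards [ae_restrict_mem measurableSet_Ioo] with x hx
    rw [hgk x hx]
  rw [hden]
  have hCk : Integrable (fun x => C * k x) m := hk.const_mul C
  have hCk0 : 0 ≤ᵐ[m] fun x => C * k x := by
    filter_upwards [ae_restrict_mem measurableSet_Ioo] with x hx
    exact mul_nonneg hC.le (hk0 x hx)
  set ν := m.withDensity (fun x => ENNReal.ofReal (C * k x)) with hν
  set Z := ∫ x, k x ∂m with hZ
  have hmass : ν univ = ENNReal.ofReal (C * Z) := by
    rw [hν, withDensity_apply _ MeasurableSet.univ, Measure.restrict_univ,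
      ← ofReal_integral_eq_lintegral_ofReal hCk hCk0, integral_const_mul]
  have hCZ : 0 < C * Z := mul_pos hC hpos
  have hint : ∀ φ : ℝ → ℝ, ∫ x, φ x ∂((ν univ)⁻¹ • ν) = (∫ x, k x * φ x ∂m) / Z := by
    intro φ
    rw [integral_smul_measure, hν, integral_withDensity_eq_integral_toReal_smul₀
      hCk.aestronglyMeasurable.aemeasurable.ennreal_ofReal
      (Eventually.of_forall fun x => ENNReal.ofReal_lt_top), ← hν, hmass, ENNReal.toReal_inv,
      ENNReal.toReal_ofReal hCZ.le]
    have : ∫ x, (ENNReal.ofReal (C * k x)).toReal • φ x ∂m = ∫ x, C * (k x * φ x) ∂m := by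
      refine integral_congr_ae ?_
      filter_upwards [hCk0] with x hx
      rw [ENNReal.toReal_ofReal hx, smul_eq_mul, mul_assoc]
    rw [this, integral_const_mul, smul_eq_mul]
    have := hpos.ne'
    field_simp
  have hprob : IsProbabilityMeasure ((ν univ)⁻¹ • ν) := by
    constructor
    rw [Measure.smul_apply, smul_eq_mul]
    refine ENNReal.inv_mul_cancel ?_ ?_ <;> rw [hmass]
    · simpa using hCZ
    · exact ENNReal.ofReal_ne_top
  have hbdd : MemLp (fun x : ℝ => x - a) 2 ((ν univ)⁻¹ • ν) := by
    refine MemLp.of_bound (by fun_prop) (1 + |a|) ?_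
    have hac : (ν univ)⁻¹ • ν ≪ m :=
      (Measure.smul_absolutelyContinuous).trans (withDensity_absolutelyContinuous _ _)
    refine hac.ae_le ?_
    filter_upwards [ae_restrict_mem measurableSet_Ioo] with x hx
    have : |x| ≤ 1 := abs_le.2 ⟨hx.1.le, hx.2.le⟩
    exact (abs_sub x a).trans (by linarith)
  have hv := variance_sub_const (X := (id : ℝ → ℝ)) (μ := (ν univ)⁻¹ • ν) (by fun_prop) a
  rw [← hv]
  simp only [id]
  rw [variance_eq_sub hbdd, hint (fun x => x - a)]
  simp only [Pi.pow_apply]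
  rw [hint (fun x => (x - a) ^ 2)]

/-- Information about the correlation `ρ` per treated (or control) unit, for the cross effect `c`
of the standardised unobserved intermediate and noise variance `v`. -/
def armInfo (v c ρ : ℝ) : ℝ :=
  c ^ 2 * (2 * ρ ^ 2 * c ^ 2 / regVar v c ρ ^ 2 + 1 / regVar v c ρ)

lemma armInfo_nonneg {v : ℝ} (hv : 0 < v) (c : ℝ) {ρ : ℝ} (hρ : ρ ∈ Icc (-1 : ℝ) 1) :
    0 ≤ armInfo v c ρ := by
  have := regVar_pos hv c hρ
  unfold armInfo
  positivity

lemma armInfo_pos {v c : ℝ} (hv : 0 < v) (hc : c ≠ 0) {ρ : ℝ} (hρ : ρ ∈ Icc (-1 : ℝ) 1) :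
    0 < armInfo v c ρ := by
  have := regVar_pos hv c hρ
  unfold armInfo
  positivity

lemma weighted_armInfo_pos {v c₀ c₁ : ℝ} (hv : 0 < v) (hc : c₀ ≠ 0 ∨ c₁ ≠ 0) {ρ : ℝ}
    (hρ : ρ ∈ Icc (-1 : ℝ) 1) {a b : ℝ} (ha : 0 < a) (hb : 0 < b) :
    0 < a * armInfo v c₁ ρ + b * armInfo v c₀ ρ := by
  have h0 := armInfo_nonneg hv c₀ hρ
  have h1 := armInfo_nonneg hv c₁ hρ
  rcases hc with h | h
  · have := armInfo_pos hv h hρ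
    positivity
  · have := armInfo_pos hv h hρ
    positivity

lemma zeta_sub_psi_sq_zero (θ : Params p) (ρ : ℝ) :
    θ.zeta ρ 0 - θ.psi ρ 0 ^ 2 = θ.σy ^ 2 + (1 - ρ ^ 2) * θ.β 0 1 ^ 2 * θ.σs 1 ^ 2 := by
  simp [Params.zeta, Params.psi, Params.covS, dotProduct, Matrix.mulVec, Fin.sum_univ_two]
  ring

lemma zeta_sub_psi_sq_one (θ : Params p) (ρ : ℝ) :
    θ.zeta ρ 1 - θ.psi ρ 1 ^ 2 = θ.σy ^ 2 + (1 - ρ ^ 2) * θ.β 1 0 ^ 2 * θ.σs 0 ^ 2 := by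
  simp [Params.zeta, Params.psi, Params.covS, dotProduct, Matrix.mulVec, Fin.sum_univ_two]
  ring

lemma info_eq (θ : Params p) (ρ τ : ℝ) :
    θ.info ρ τ = τ * armInfo (θ.σy ^ 2) (θ.cross 1) ρ +
      (1 - τ) * armInfo (θ.σy ^ 2) (θ.cross 0) ρ := by
  have h1 : regVar (θ.σy ^ 2) (θ.cross 1) ρ = θ.zeta ρ 1 - θ.psi ρ 1 ^ 2 := by
    rw [zeta_sub_psi_sq_one, regVar, Params.cross]
    simp
    ring
  have h0 : regVar (θ.σy ^ 2) (θ.cross 0) ρ = θ.zeta ρ 0 - θ.psi ρ 0 ^ 2 := by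
    rw [zeta_sub_psi_sq_zero, regVar, Params.cross]
    simp
    ring
  have c1 : θ.cross 1 = θ.β 1 0 * θ.σs 0 := by simp [Params.cross]
  have c0 : θ.cross 0 = θ.β 0 1 * θ.σs 1 := by simp [Params.cross]
  rw [armInfo, armInfo, h1, h0, Params.info, c1, c0]
  ring

/-- As the cross effects vanish the information vanishes, so the approximate posterior variance
explodes. -/
lemma tendsto_inv_info_withCross (θ : Params p) (hσy : 0 < θ.σy) (hσs : ∀ t, 0 < θ.σs t) {ρ : ℝ}
    (hρ : ρ ∈ Icc (-1 : ℝ) 1) {n : ℕ} {τ : ℝ} (hn : 1 ≤ n) (hτ : τ ∈ Ioo (0 : ℝ) 1) :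
    Tendsto (fun b : ℝ × ℝ => (n : ℝ)⁻¹ * ((θ.withCross b.1 b.2).info ρ τ)⁻¹)
      (𝓝[≠] (0, 0)) atTop := by
  have hv : 0 < θ.σy ^ 2 := by positivity
  have hinfo : ∀ b : ℝ × ℝ, (θ.withCross b.1 b.2).info ρ τ =
      τ * armInfo (θ.σy ^ 2) (b.2 * θ.σs 0) ρ + (1 - τ) * armInfo (θ.σy ^ 2) (b.1 * θ.σs 1) ρ := by
    intro b
    rw [info_eq]
    simp [Params.withCross, Params.cross]
  have hcont : Continuous fun c => armInfo (θ.σy ^ 2) c ρ := by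
    have hV : ∀ c, regVar (θ.σy ^ 2) c ρ ≠ 0 := fun c => (regVar_pos hv c hρ).ne'
    have hVc : Continuous fun c => regVar (θ.σy ^ 2) c ρ := by
      unfold regVar
      fun_prop
    unfold armInfo
    fun_prop (disch := simpa using hV)
  simp_rw [hinfo]
  have hpos : (0 : ℝ) < (n : ℝ)⁻¹ := by positivity
  refine Tendsto.const_mul_atTop hpos (Tendsto.inv_tendsto_nhdsGT_zero ?_)
  refine tendsto_nhdsWithin_iff.2 ⟨?_, ?_⟩
  · have : Continuous fun b : ℝ × ℝ => τ * armInfo (θ.σy ^ 2) (b.2 * θ.σs 0) ρ +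
        (1 - τ) * armInfo (θ.σy ^ 2) (b.1 * θ.σs 1) ρ := by fun_prop
    have h0 := (this.tendsto (0, 0)).mono_left (nhdsWithin_le_nhds (s := {(0, 0)}ᶜ))
    simpa [armInfo] using h0
  · filter_upwards [self_mem_nhdsWithin] with b hb
    refine weighted_armInfo_pos hv ?_ hρ hτ.1 (sub_pos.2 hτ.2)
    by_contra! hcon
    refine hb (Prod.ext ?_ ?_)
    · exact (mul_eq_zero.1 hcon.1).resolve_right (hσs 1).ne'
    · exact (mul_eq_zero.1 hcon.2).resolve_right (hσs 0).ne'

/-- The likelihood of `ρ` is, up to a factor free of `ρ`, the exponential of `n` times a function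
linear in the averages of the sufficient statistics. -/
lemma exists_prod_obsDensity_eq (θ : Params p) (hσy : 0 < θ.σy) (hσs : ∀ t, 0 < θ.σs t) (n : ℕ)
    (x : ℕ → Fin p → ℝ) (t : ℕ → Fin 2) (s y : ℕ → ℝ) :
    ∃ C > 0, ∀ ρ ∈ Ioo (-1 : ℝ) 1, ∏ i ∈ Finset.range n, obsDensity θ ρ (x i) (t i) (s i) (y i) =
      C * Real.exp (n * ∑ k : Fin 2 × Fin 4,
        (∑ i ∈ Finset.range n, armStat θ k.1 k.2 (x i) (t i) (s i) (y i)) / n *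
          llCoef (θ.σy ^ 2) (θ.cross k.1) k.2 ρ) := by
  refine ⟨∏ i ∈ Finset.range n, ((2 * Real.pi * θ.σs (t i))⁻¹ *
    Real.exp (-θ.stdS (x i) (t i) (s i) ^ 2 / 2)), Finset.prod_pos fun i _ => ?_, fun ρ hρ => ?_⟩
  · have := hσs (t i)
    have := Real.pi_pos
    positivity
  · rw [Finset.prod_congr rfl fun i _ => obsDensity_eq θ hσy hσs hρ (x i) (t i) (s i) (y i),
      Finset.prod_mul_distrib, ← Real.exp_sum]
    congr 2
    rcases Nat.eq_zero_or_pos n with rfl | hn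
    · simp
    have hn' : (n : ℝ) ≠ 0 := by positivity
    simp_rw [regLogLik_eq_sum, ← sum_armStat_mul θ _ _ _ _
      (fun t j => llCoef (θ.σy ^ 2) (θ.cross t) j ρ)]
    rw [Finset.sum_comm, Finset.mul_sum]
    refine Finset.sum_congr rfl fun k _ => ?_
    rw [← Finset.sum_mul]
    field_simp

lemma sum_arm_weights {a : Fin 2 → ℝ} {g h : Fin 2 → Fin 4 → ℝ} :
    ∑ k : Fin 2 × Fin 4, a k.1 * g k.1 k.2 * h k.1 k.2 =
      a 0 * ∑ j, g 0 j * h 0 j + a 1 * ∑ j, g 1 j * h 1 j := by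
  rw [Fintype.sum_prod_type, Fin.sum_univ_two, Finset.mul_sum, Finset.mul_sum]
  simp_rw [mul_assoc]

/-- The limiting log-likelihood has a strict maximum at the true correlation. -/
lemma sum_arms_llCoef_lt {v : ℝ} (hv : 0 < v) {c : Fin 2 → ℝ} (hc : c 0 ≠ 0 ∨ c 1 ≠ 0) {ρ : ℝ}
    (hρ : ρ ∈ Icc (-1 : ℝ) 1) {a : Fin 2 → ℝ} (ha : ∀ t, 0 < a t) {z : ℝ}
    (hz : z ∈ Icc (-1 : ℝ) 1) (hzρ : z ≠ ρ) :
    ∑ k : Fin 2 × Fin 4, a k.1 * llMean v (c k.1) ρ k.2 * llCoef v (c k.1) k.2 z <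
      ∑ k : Fin 2 × Fin 4, a k.1 * llMean v (c k.1) ρ k.2 * llCoef v (c k.1) k.2 ρ := by
  rw [sum_arm_weights (g := fun t => llMean v (c t) ρ) (h := fun t j => llCoef v (c t) j z),
    sum_arm_weights (g := fun t => llMean v (c t) ρ) (h := fun t j => llCoef v (c t) j ρ)]
  have h0 := sum_llMean_mul_llCoef_le hv (c 0) hρ hz
  have h1 := sum_llMean_mul_llCoef_le hv (c 1) hρ hz
  have hV0 := regVar_pos hv (c 0) hz
  have hV1 := regVar_pos hv (c 1) hz
  have hd : 0 < (z - ρ) ^ 2 := by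
    have := sub_ne_zero.2 hzρ
    positivity
  have g0 : 0 ≤ c 0 ^ 2 * (z - ρ) ^ 2 / (2 * regVar v (c 0) z) := by positivity
  have g1 : 0 ≤ c 1 ^ 2 * (z - ρ) ^ 2 / (2 * regVar v (c 1) z) := by positivity
  rcases hc with hc | hc
  · have g2 : 0 < c 0 ^ 2 * (z - ρ) ^ 2 / (2 * regVar v (c 0) z) := by positivity
    exact add_lt_add_of_lt_of_le (mul_lt_mul_of_pos_left (by linarith) (ha 0))
      (mul_le_mul_of_nonneg_left (by linarith) (ha 1).le)
  · have g2 : 0 < c 1 ^ 2 * (z - ρ) ^ 2 / (2 * regVar v (c 1) z) := by positivity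
    exact add_lt_add_of_le_of_lt (mul_le_mul_of_nonneg_left (by linarith) (ha 0).le)
      (mul_lt_mul_of_pos_left (by linarith) (ha 1))

/-- The curvature of the limiting log-likelihood at the true correlation is minus the
information. -/
lemma sum_arms_llCoefDeriv2 {v : ℝ} (hv : 0 < v) {c : Fin 2 → ℝ} {ρ : ℝ}
    (hρ : ρ ∈ Icc (-1 : ℝ) 1) {a : Fin 2 → ℝ} :
    ∑ k : Fin 2 × Fin 4, a k.1 * llMean v (c k.1) ρ k.2 * llCoefDeriv2 v (c k.1) k.2 ρ =
      -(a 1 * armInfo v (c 1) ρ + a 0 * armInfo v (c 0) ρ) := by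
  rw [sum_arm_weights (g := fun t => llMean v (c t) ρ) (h := fun t j => llCoefDeriv2 v (c t) j ρ),
    sum_llMean_mul_llCoefDeriv2 hv _ hρ, sum_llMean_mul_llCoefDeriv2 hv _ hρ, armInfo, armInfo]
  ring

lemma continuousOn_llCoef {v : ℝ} (hv : 0 < v) (c : ℝ) (j : Fin 4) :
    ContinuousOn (llCoef v c j) (Icc (-1 : ℝ) 1) := fun _ hz =>
  (hasDerivAt_llCoef hv c j hz).continuousAt.continuousWithinAt

/-- `exists_laplace_centers` for the log-likelihood of the two treatment arms. -/
lemma exists_laplace_centers_llCoef {v : ℝ} (hv : 0 < v) {c : Fin 2 → ℝ} (hc : c 0 ≠ 0 ∨ c 1 ≠ 0)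
    {ρ : ℝ} (hρ : ρ ∈ Ioo (-1 : ℝ) 1) {a : Fin 2 → ℝ} (ha : ∀ t, 0 < a t)
    {q : ℕ → Fin 2 × Fin 4 → ℝ}
    (hq : Tendsto q atTop (𝓝 fun k => a k.1 * llMean v (c k.1) ρ k.2)) :
    ∃ r : ℕ → ℝ, Tendsto r atTop (𝓝 ρ) ∧ (∀ n, r n ∈ Icc (-1 : ℝ) 1) ∧
      (∀ ε > 0, ∃ δ > 0, ∀ᶠ n in atTop, ∀ x, |x - r n| < δ →
        |∑ k, q n k * llCoef v (c k.1) k.2 x - ∑ k, q n k * llCoef v (c k.1) k.2 (r n) +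
          (a 1 * armInfo v (c 1) ρ + a 0 * armInfo v (c 0) ρ) / 2 * (x - r n) ^ 2| ≤
            ε * (x - r n) ^ 2) ∧
      (∀ δ > 0, ∃ η > 0, ∀ᶠ n in atTop, ∀ x ∈ Icc (-1 : ℝ) 1, δ ≤ |x - r n| →
        ∑ k, q n k * llCoef v (c k.1) k.2 x ≤ ∑ k, q n k * llCoef v (c k.1) k.2 (r n) - η) := by
  have hρ' : ρ ∈ Icc (-1 : ℝ) 1 := Ioo_subset_Icc_self hρ
  have hcont : ∀ k : Fin 2 × Fin 4, ContinuousOn (llCoef v (c k.1) k.2) (Icc (-1 : ℝ) 1) :=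
    fun k => continuousOn_llCoef hv (c k.1) k.2
  have hder : ∀ k : Fin 2 × Fin 4, ∀ z ∈ Ioo (-1 : ℝ) 1,
      HasDerivAt (llCoef v (c k.1) k.2) (llCoefDeriv v (c k.1) k.2 z) z :=
    fun k _ hz => hasDerivAt_llCoef hv (c k.1) k.2 (Ioo_subset_Icc_self hz)
  have hder2 : ∀ k : Fin 2 × Fin 4, ∀ z ∈ Ioo (-1 : ℝ) 1,
      HasDerivAt (llCoefDeriv v (c k.1) k.2) (llCoefDeriv2 v (c k.1) k.2 z) z :=
    fun k _ hz => hasDerivAt_llCoefDeriv hv (c k.1) k.2 (Ioo_subset_Icc_self hz)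
  have hcont2 : ∀ k : Fin 2 × Fin 4, ContinuousAt (llCoefDeriv2 v (c k.1) k.2) ρ :=
    fun k => continuousAt_llCoefDeriv2 hv (c k.1) k.2 hρ'
  have hmax := fun z hz hzρ => sum_arms_llCoef_lt hv hc hρ' ha (z := z) hz hzρ
  have hcenters := exists_laplace_centers hρ hq hcont hder hder2 hcont2 hmax
    (sum_arms_llCoefDeriv2 hv (c := c) (a := a) hρ')
  exact hcenters

/-- Deterministic core: along any data sequence whose averaged sufficient statistics converge to
their model expectations, the posterior variance is asymptotically the inverse information. -/
theorem tendsto_nat_mul_variance_rhoPosterior (θ : Params p) (hσy : 0 < θ.σy)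
    (hσs : ∀ t, 0 < θ.σs t) (hPI : θ.β 0 1 ≠ 0 ∨ θ.β 1 0 ≠ 0) {ρ : ℝ} (hρ : ρ ∈ Ioo (-1 : ℝ) 1)
    {a : Fin 2 → ℝ} (ha : ∀ t, 0 < a t) {x : ℕ → Fin p → ℝ} {t : ℕ → Fin 2} {s y : ℕ → ℝ}
    (hlim : Tendsto (fun (n : ℕ) (k : Fin 2 × Fin 4) => (∑ i ∈ Finset.range n,
        armStat θ k.1 k.2 (x i) (t i) (s i) (y i)) / n) atTop
      (𝓝 fun k => a k.1 * llMean (θ.σy ^ 2) (θ.cross k.1) ρ k.2))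
    {f : ℝ → ℝ} (hf_nonneg : ∀ r ∈ Ioo (-1 : ℝ) 1, 0 ≤ f r)
    (hf_int : IntegrableOn f (Ioo (-1 : ℝ) 1)) (hf_cont : ContinuousAt f ρ) (hf_pos : 0 < f ρ) :
    Tendsto (fun n : ℕ => (n : ℝ) * Var[id; rhoPosterior θ f n x t s y]) atTop
      (𝓝 (a 1 * armInfo (θ.σy ^ 2) (θ.cross 1) ρ + a 0 * armInfo (θ.σy ^ 2) (θ.cross 0) ρ)⁻¹) := by
  have hv : 0 < θ.σy ^ 2 := by positivity
  have hρ' : ρ ∈ Icc (-1 : ℝ) 1 := Ioo_subset_Icc_self hρ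
  have hcross : θ.cross 0 ≠ 0 ∨ θ.cross 1 ≠ 0 := by
    refine hPI.imp (fun h => ?_) fun h => ?_
    · simpa [Params.cross] using ⟨h, (hσs 1).ne'⟩
    · simpa [Params.cross] using ⟨h, (hσs 0).ne'⟩
  set I := a 1 * armInfo (θ.σy ^ 2) (θ.cross 1) ρ + a 0 * armInfo (θ.σy ^ 2) (θ.cross 0) ρ with hI
  have hIpos : 0 < I := weighted_armInfo_pos hv hcross hρ' (ha 1) (ha 0)
  obtain ⟨r, hr, hr1, hloc, hfar⟩ := exists_laplace_centers_llCoef hv hcross hρ ha hlim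
  set G : ℕ → ℝ → ℝ := fun n z => ∑ k : Fin 2 × Fin 4, (∑ i ∈ Finset.range n,
    armStat θ k.1 k.2 (x i) (t i) (s i) (y i)) / n * llCoef (θ.σy ^ 2) (θ.cross k.1) k.2 z with hG
  have hGc : ∀ n, ContinuousOn (G n) (Icc (-1 : ℝ) 1) := fun n =>
    continuousOn_finsetSum _ fun k _ => (continuousOn_llCoef hv _ _).const_mul _
  obtain ⟨hmass, hvar⟩ := tendsto_laplace_variance hIpos hf_pos fun k =>
    tendsto_laplace_moment hIpos hρ hr hr1 hGc hloc hfar hf_int hf_cont k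
  refine hvar.congr' ?_
  -- for large `n` the posterior mass is positive, so the normalisation is not a junk value
  filter_upwards [hmass] with n hn
  congr 1
  symm
  obtain ⟨C, hC, hprod⟩ := exists_prod_obsDensity_eq θ hσy hσs n x t s y
  have hk := integrableOn_mul_pow_mul_exp hf_int (hGc n) (r n) n 0
  simp only [pow_zero, mul_one] at hn hk ⊢
  unfold rhoPosterior rhoPosteriorUnnorm
  rw [variance_normalized_withDensity (C := C * Real.exp (n * G n (r n)))
    (k := fun z => f z * Real.exp (n * (G n z - G n (r n)))) (by positivity) (r n) ?_
    (fun z hz => mul_nonneg (hf_nonneg z hz) (Real.exp_pos _).le) hk hn]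
  · simp only [pow_one, mul_right_comm]
  · intro z hz
    rw [hprod z hz]
    have e : Real.exp (n * G n z) =
        Real.exp (n * G n (r n)) * Real.exp (n * (G n z - G n (r n))) := by
      rw [← Real.exp_add]
      congr 1
      ring
    change f z * (C * Real.exp (n * G n z)) = _
    rw [e]
    ring

lemma treatedFraction_eq {Ω : Type*} (θ : Params p) (T : ℕ → Ω → Fin 2) (x : ℕ → Fin p → ℝ)
    (s y : ℕ → ℝ) (n : ℕ) (ω : Ω) : treatedFraction T n ω =
      (∑ i ∈ Finset.range n, armStat θ 1 0 (x i) (T i ω) (s i) (y i)) / n := by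
  unfold treatedFraction
  congr 1
  refine Finset.sum_congr rfl fun i _ => ?_
  generalize T i ω = τ
  fin_cases τ <;> simp [armStat, llStat]

end PrincipalStrat

end

theorem theorem2 {p : ℕ} {Ω : Type*} [MeasurableSpace Ω] (P : Measure Ω) [IsProbabilityMeasure P]
    (θ : PrincipalStrat.Params p) (hσy : 0 < θ.σy) (hσs : ∀ t, 0 < θ.σs t)
    (hPI : θ.β 0 1 ≠ 0 ∨ θ.β 1 0 ≠ 0)
    (ρ : ℝ) (hρ : ρ ∈ Set.Ioo (-1 : ℝ) 1)
    (X : ℕ → Ω → Fin p → ℝ) (T : ℕ → Ω → Fin 2)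
    (U : ℕ → Ω → EuclideanSpace ℝ (Fin 2)) (Y : ℕ → Ω → Fin 2 → ℝ)
    (hsample : PrincipalStrat.IsModelSample P θ ρ X T U Y)
    (f : ℝ → ℝ) (hf_nonneg : ∀ r ∈ Set.Ioo (-1 : ℝ) 1, 0 ≤ f r)
    (hf_int : IntegrableOn f (Set.Ioo (-1 : ℝ) 1))
    (hf_cont : ContinuousAt f ρ) (hf_pos : 0 < f ρ) :
    (∀ᵐ ω ∂P,
      (fun n : ℕ => PrincipalStrat.posteriorVar θ f X T U Y n ω) ~[atTop]
        fun n : ℕ => (n : ℝ)⁻¹ * (θ.info ρ (PrincipalStrat.treatedFraction T n ω))⁻¹) ∧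
    θ.zeta ρ 0 - θ.psi ρ 0 ^ 2 = θ.σy ^ 2 + (1 - ρ ^ 2) * θ.β 0 1 ^ 2 * θ.σs 1 ^ 2 ∧
    θ.zeta ρ 1 - θ.psi ρ 1 ^ 2 = θ.σy ^ 2 + (1 - ρ ^ 2) * θ.β 1 0 ^ 2 * θ.σs 0 ^ 2 ∧
    (∀ (n : ℕ) (τ : ℝ), 1 ≤ n → τ ∈ Set.Ioo (0 : ℝ) 1 →
      Tendsto (fun b : ℝ × ℝ => (n : ℝ)⁻¹ * ((θ.withCross b.1 b.2).info ρ τ)⁻¹)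
        (𝓝[≠] (0, 0)) atTop) := by
  refine ⟨?_, PrincipalStrat.zeta_sub_psi_sq_zero θ ρ, PrincipalStrat.zeta_sub_psi_sq_one θ ρ,
    fun n τ hn hτ => PrincipalStrat.tendsto_inv_info_withCross θ hσy hσs
      (Ioo_subset_Icc_self hρ) hn hτ⟩
  filter_upwards [hsample.tendsto_average_armStat hσs hρ] with ω hω
  have hvar := PrincipalStrat.tendsto_nat_mul_variance_rhoPosterior θ hσy hσs hPI hρ
    (a := fun t => P.real (T 0 ⁻¹' {t})) hsample.arm_prob_pos hω hf_nonneg hf_int hf_cont hf_pos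
  -- `T̄` converges to the treatment probability, hence the information to its limit
  have hT : Tendsto (fun n => PrincipalStrat.treatedFraction T n ω) atTop
      (𝓝 (P.real (T 0 ⁻¹' {1}))) := by
    have h := tendsto_pi_nhds.1 hω (1, 0)
    simp only [PrincipalStrat.llMean, Matrix.cons_val, mul_one] at h
    exact h.congr fun n => (PrincipalStrat.treatedFraction_eq θ T _ _ _ n ω).symm
  have hI : Tendsto (fun n => θ.info ρ (PrincipalStrat.treatedFraction T n ω)) atTop
      (𝓝 (P.real (T 0 ⁻¹' {1}) * PrincipalStrat.armInfo (θ.σy ^ 2) (θ.cross 1) ρ +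
        P.real (T 0 ⁻¹' {0}) * PrincipalStrat.armInfo (θ.σy ^ 2) (θ.cross 0) ρ)) := by
    rw [hsample.arm_prob_zero]
    simp_rw [PrincipalStrat.info_eq]
    exact (hT.mul_const _).add ((hT.const_sub 1).mul_const _)
  have hcross : θ.cross 0 ≠ 0 ∨ θ.cross 1 ≠ 0 := by
    refine hPI.imp (fun h => ?_) fun h => ?_
    · simpa [PrincipalStrat.Params.cross] using ⟨h, (hσs 1).ne'⟩
    · simpa [PrincipalStrat.Params.cross] using ⟨h, (hσs 0).ne'⟩
  have hpos := PrincipalStrat.weighted_armInfo_pos (v := θ.σy ^ 2) (by positivity) hcross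
    (Ioo_subset_Icc_self hρ) (hsample.arm_prob_pos 1) (hsample.arm_prob_pos 0)
  refine Asymptotics.isEquivalent_of_tendsto_one ?_
  have hprod := hvar.mul hI
  rw [inv_mul_cancel₀ hpos.ne'] at hprod
  refine hprod.congr fun n => ?_
  rw [Pi.div_apply, PrincipalStrat.posteriorVar, ← mul_inv, div_inv_eq_mul]
  ring
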